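/- Conventions. A continuum is a nondegenerate compact connected metrizable space. It is indecomposable if it is not the union of two proper subcontinua, and hereditarily indecomposable if each of its subcontinua is indecomposable. It is arc-like if for every $\varepsilon>0$ (and a compatible metric) it admits a continuous map to $[0,1]$ all of whose fibers have diameter less than $\varepsilon$. A pseudo-arc is a hereditarily indecomposable arc-like continuum. A 2-disk is a space homeomorphic to the closed unit disk in $\mathbb{C}$. A branched $q$-to-1 cover with one branch point $b$ is a continuous map $f\colon X\to Y$, with $b\in Y$, such that $f$ is a covering map with fibers of $q$ points over $Y\setminus\{b\}$, and $f^{-1}(b)$ is a single point. For a sequence of primes $\mathbb{P}=(q_n)_{n\ge 0}$, the $\mathbb{P}$-adic odometer $\phi_{\mathbb{P}}\colon\Lambda\to\Lambda$ is the map $(x_n)_n\mapsto(x_n+1)_n$ on $\Lambda=\varprojlim_n \mathbb{Z}/(q_0q_1\cdots q_{n-1})$. For a map $f$, $\mathrm{Per}(f)$ is the set of its periodic points and $\omega(f,x)$ is the $\omega$-limit set of $x$. Theorem 1.5. Let $\mathbb{P}=(q_n)_{n\ge 0}$ be a sequence of primes, with $\mathbb{P}$-adic odometer $\phi_{\mathbb{P}}$.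 There exist planar 2-disks $S_n\subset\mathbb{C}$ ($n\ge 0$), pseudo-arcs $\mathcal{P}_n\subset S_n$, points $0_n\in\mathcal{P}_n$, and maps $\varphi_{\infty,n}\colon S_{n+1}\to S_n$, each a branched $q_n$-to-1 cover with one branch point $0_n$ and with $\varphi_{\infty,n}^{-1}(\mathcal{P}_n)=\mathcal{P}_{n+1}$, such that the inverse limit $$\mathcal{P}_\infty=\varprojlim(\mathcal{P}_n,\varphi_{\infty,n}|_{\mathcal{P}_{n+1}})$$ is a pseudo-arc, $0_\infty:=(0_n)_{n\ge 0}$ is a point of $\mathcal{P}_\infty$, and there is a homeomorphism $\hat R_\infty\colon\mathcal{P}_\infty\to\mathcal{P}_\infty$ with the following properties: 1. $\mathrm{Per}(\hat R_\infty)=\{0_\infty\}$; 2. for every $x\in\mathcal{P}_\infty\setminus\{0_\infty\}$, the map $\hat R_\infty$ sends $\omega(\hat R_\infty,x)$ into itself, and its restriction to $\omega(\hat R_\infty,x)$ is topologically conjugate to $\phi_{\mathbb{P}}$; 3. $x\in\omega(\hat R_\infty,x)$ for every $x\in\mathcal{P}_\infty$. -/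

import Mathlib

open Set Function Filter Topology Uniformity

/-! ### Inverse limits -/

/-- The inverse limit of the sequence `X 0 ← X 1 ← X 2 ← ⋯` with bonding maps `f n`, as a
subspace of the product. -/
def inverseLimit {X : ℕ → Type*} (f : ∀ n, X (n + 1) → X n) : Set (∀ n, X n) :=
  {x | ∀ n, f n (x (n + 1)) = x n}

/-- The inverse limit of the sequence of subspaces `P n` of `S n`, with the restrictions
`P (n + 1) → P n` of the maps `φ n : S (n + 1) → S n` as bonding maps. -/
abbrev subspaceInverseLimit {S : ℕ → Type*} (φ : ∀ n, S (n + 1) → S n) (P : ∀ n, Set (S n))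
    (hP : ∀ n, MapsTo (φ n) (P (n + 1)) (P n)) : Set (∀ n, P n) :=
  inverseLimit (X := fun n => P n) fun n => (hP n).restrict (φ n) (P (n + 1)) (P n)

/-! ### The pseudo-arc -/

/-- A continuum: a nondegenerate compact connected metrizable space. -/
structure IsContinuum (X : Type*) [TopologicalSpace X] : Prop where
  compact : CompactSpace X
  connected : ConnectedSpace X
  metrizable : TopologicalSpace.MetrizableSpace X
  nondegenerate : Nontrivial X

/-- A subset that is a (nondegenerate) continuum. -/
structure IsSubcontinuum {X : Type*} [TopologicalSpace X] (C : Set X) : Prop where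
  compact : IsCompact C
  connected : IsConnected C
  nondegenerate : C.Nontrivial

/-- `C` is not the union of two proper subcontinua. -/
def IsIndecomposableSet {X : Type*} [TopologicalSpace X] (C : Set X) : Prop :=
  ∀ A B : Set X, IsSubcontinuum A → IsSubcontinuum B → A ∪ B = C → A = C ∨ B = C

/-- Every subcontinuum (in particular the whole space, if it is a continuum) is
indecomposable. -/
def IsHereditarilyIndecomposable (X : Type*) [TopologicalSpace X] : Prop :=
  ∀ C : Set X, IsSubcontinuum C → IsIndecomposableSet C

/-- Arc-like spaces: the space admits continuous maps to the unit interval with arbitrarily small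
fibers. Smallness is measured by entourages, see `isArcLike_iff_dist` for the metric form. -/
def IsArcLike (X : Type*) [UniformSpace X] : Prop :=
  ∀ V ∈ 𝓤 X, ∃ p : X → unitInterval, Continuous p ∧ ∀ x y, p x = p y → (x, y) ∈ V

theorem isArcLike_iff_dist {X : Type*} [PseudoMetricSpace X] :
    IsArcLike X ↔ ∀ ε > 0, ∃ p : X → unitInterval, Continuous p ∧
      ∀ x y, p x = p y → dist x y < ε := by
  constructor
  · intro h ε hε
    exact h _ (Metric.dist_mem_uniformity hε)
  · intro h V hV
    obtain ⟨ε, hε, hsub⟩ := Metric.mem_uniformity_dist.1 hV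
    obtain ⟨p, hp, hfib⟩ := h ε hε
    exact ⟨p, hp, fun x y hxy => hsub (hfib x y hxy)⟩

/-- A pseudo-arc: a hereditarily indecomposable arc-like continuum. -/
structure IsPseudoArc (X : Type*) [UniformSpace X] : Prop where
  continuum : IsContinuum X
  arcLike : IsArcLike X
  hereditarilyIndecomposable : IsHereditarilyIndecomposable X

/-! ### Disks and branched covers -/

/-- A 2-disk: a space homeomorphic to the closed unit disk in the plane. -/
def IsTwoDisk (X : Type*) [TopologicalSpace X] : Prop :=
  Nonempty (X ≃ₜ Metric.closedBall (0 : ℂ) 1)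

/-- `f` is a branched `q`-to-1 cover whose only branch point (in the target) is `b`: it is a
`q`-sheeted covering map over the complement of `b`, and the fiber over `b` is a single point. -/
structure IsBranchedCover {X Y : Type*} [TopologicalSpace X] [TopologicalSpace Y]
    (f : X → Y) (q : ℕ) (b : Y) : Prop where
  continuous : Continuous f
  covering : IsCoveringMapOn f {b}ᶜ
  sheets : ∀ y, y ≠ b → (f ⁻¹' {y}).ncard = q
  branch : ∃! x, f x = b

/-! ### Odometers -/

/-- The product `q 0 * ⋯ * q (n - 1)`. -/
def odometerModulus (q : ℕ → ℕ) (n : ℕ) : ℕ := ∏ i ∈ Finset.range n, q i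

/-- Reduction `ℤ / (q 0 ⋯ q n) → ℤ / (q 0 ⋯ q (n - 1))`. -/
def odometerBond (q : ℕ → ℕ) (n : ℕ) :
    ZMod (odometerModulus q (n + 1)) →+* ZMod (odometerModulus q n) :=
  ZMod.castHom (Dvd.intro (q n) (Finset.prod_range_succ q n).symm) _

/-- The phase space of the odometer: the inverse limit of the cyclic groups
`ℤ / (q 0 ⋯ q (n - 1))` (with their discrete topologies). -/
abbrev OdometerSpace (q : ℕ → ℕ) : Type :=
  inverseLimit (X := fun n => ZMod (odometerModulus q n)) fun n => ⇑(odometerBond q n)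

/-- The odometer: addition of `1` in every coordinate. -/
def odometer (q : ℕ → ℕ) (x : OdometerSpace q) : OdometerSpace q :=
  ⟨fun n => x.1 n + 1, fun n => by
    have h : odometerBond q n (x.1 (n + 1)) = x.1 n := x.2 n
    change odometerBond q n (x.1 (n + 1) + 1) = x.1 n + 1
    rw [map_add, map_one, h]⟩

/-! ### Dynamics -/

/-- The ω-limit set of the point `x` under the map `f`. -/
def omegaLimitSet {X : Type*} [TopologicalSpace X] (f : X → X) (x : X) : Set X :=
  omegaLimit atTop (fun (k : ℕ) (y : X) => f^[k] y) {x}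

/-- Topological conjugacy of two maps. -/
def IsTopologicallyConjugate {X Y : Type*} [TopologicalSpace X] [TopologicalSpace Y]
    (f : X → X) (g : Y → Y) : Prop :=
  ∃ h : X ≃ₜ Y, Semiconj h f g

/-! Every `S n` is the closed unit disk and every bonding map is the power map `z ↦ z ^ q n`.
Everything then rests on one planar continuum `P` containing 0 and 1 whose preimages under all power
maps `z ↦ z ^ N`, `N ≠ 0`, are pseudo-arcs (`exists_planar_continuum`). The n-th pseudo-arc is the
preimage of `P` for the exponent `q 0 ⋯ q (n - 1)`. It is invariant under multiplication by roots of
unity of that order, and compatible sequences of such roots form the odometer group. The group acts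
on the inverse limit, and its generator is the desired homeomorphism. Away from the zero thread all
coordinates are nonzero, so the action is free, and each ω-limit set is an injective continuous
image of the compact group. This gives all the dynamical claims.

`P` is a nested intersection of images of the disk under injective maps `z ↦ z * exp (κ z)`. Such a
map lifts through `z ↦ z ^ N` by the formula `z * exp (κ (z ^ N) / N)`, and the image of the lift is
the full preimage of the image (`ExpMap.image_lift`). Hence one sequence of maps can serve all `N`:
the pairs `(N, ε)` are enumerated, and each step composes on the inside with a map that makes the
`N`-th preimage thin and crooked at scale `ε`. Later steps only shrink the disks, and crookedness is
inherited.

One step has two halves. A spiral (`ExpMap.exists_spiral`) makes the lifted disk thin over a single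
real function `g`; zigzags (`ExpMap.exists_zigzag`) then force `g` to fold between any two separated
levels of a finite grid. The zigzags follow a path that folds finitely many real functions
simultaneously (`exists_isFolded_finite`).

Crooked maps with arbitrarily small fibers imply both arc-likeness and hereditary indecomposability.
They also pull back along the coordinate projections, so the same criterion applies to the inverse
limit. -/

/-! ### Crookedness -/

/-- `X` folds over between the levels `a` and `b` of `g`: it decomposes into three closed pieces
along which one first rises from below `a` to almost `b`, then falls back almost to `a`, and only
then rises to `b`. -/
def IsCrookedBetween {X : Type*} [TopologicalSpace X] (g : X → ℝ) (a b η : ℝ) : Prop :=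
  ∃ X₀ X₁ X₂ : Set X, IsClosed X₀ ∧ IsClosed X₁ ∧ IsClosed X₂ ∧
    (∀ x, x ∈ X₀ ∨ x ∈ X₁ ∨ x ∈ X₂) ∧ (∀ x, x ∈ X₀ → x ∉ X₂) ∧
    (∀ x, g x ≤ a → x ∈ X₀) ∧ (∀ x, b ≤ g x → x ∈ X₂) ∧
    (∀ x, x ∈ X₀ → x ∈ X₁ → b - η < g x) ∧ (∀ x, x ∈ X₁ → x ∈ X₂ → g x < a + η)

/-- Inheritance under precomposition is what lets crookedness survive later construction steps,
restriction to smaller sets and passage to the inverse limit. -/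
theorem IsCrookedBetween.comp {X Y : Type*} [TopologicalSpace X] [TopologicalSpace Y]
    {g : X → ℝ} {a b η : ℝ} (h : IsCrookedBetween g a b η) {φ : Y → X} (hφ : Continuous φ) :
    IsCrookedBetween (g ∘ φ) a b η := by
  obtain ⟨X₀, X₁, X₂, c₀, c₁, c₂, hc, hd, ha, hb, h₀, h₁⟩ := h
  exact ⟨φ ⁻¹' X₀, φ ⁻¹' X₁, φ ⁻¹' X₂, c₀.preimage hφ, c₁.preimage hφ, c₂.preimage hφ,
    fun x => hc _, fun x => hd _, fun x => ha _, fun x => hb _, fun x => h₀ _, fun x => h₁ _⟩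

/-- `X` admits a nonnegative continuous function with `V`-small fibers between all of whose
sufficiently separated levels `X` is crooked. -/
def HasCrookedMap (X : Type*) [TopologicalSpace X] (V : Set (X × X)) : Prop :=
  ∃ g : X → ℝ, Continuous g ∧ ∃ η > 0, (∀ x y, |g x - g y| ≤ 2 * η → (x, y) ∈ V) ∧
    (∀ x, 0 ≤ g x) ∧ ∀ i j : ℕ, i + 2 ≤ j → IsCrookedBetween g (i * η) (j * η) η

theorem HasCrookedMap.comap {X Y : Type*} [TopologicalSpace X] [TopologicalSpace Y]
    {V : Set (X × X)} (h : HasCrookedMap X V) {φ : Y → X} (hφ : Continuous φ) :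
    HasCrookedMap Y (Prod.map φ φ ⁻¹' V) := by
  obtain ⟨g, hg, η, hη, hV, h0, hc⟩ := h
  exact ⟨g ∘ φ, hg.comp hφ, η, hη, fun x y hxy => hV _ _ hxy, fun x => h0 _,
    fun i j hij => (hc i j hij).comp hφ⟩

theorem HasCrookedMap.mono {X : Type*} [TopologicalSpace X] {V W : Set (X × X)}
    (h : HasCrookedMap X V) (hVW : V ⊆ W) : HasCrookedMap X W := by
  obtain ⟨g, hg, η, hη, hV, h0, hc⟩ := h
  exact ⟨g, hg, η, hη, fun x y hxy => hVW (hV _ _ hxy), h0, hc⟩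

/-- `A` meets `X₀` and could leave it only through `X₀ ∩ X₁`, where `g` exceeds `b - η`. Dually `B`
is trapped in `X₂`. The common point `r` would then lie in two disjoint pieces. -/
theorem IsCrookedBetween.not_connected_union {X : Type*} [TopologicalSpace X] {g : X → ℝ}
    {a b η : ℝ} (h : IsCrookedBetween g a b η) {A B : Set X} (hA : IsPreconnected A)
    (hB : IsPreconnected B) {p q r : X} (hp : p ∈ A) (hq : q ∈ B) (hrA : r ∈ A) (hrB : r ∈ B)
    (hpa : g p ≤ a) (hqb : b ≤ g q) (hAb : ∀ x ∈ A, g x ≤ b - η)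
    (hBa : ∀ x ∈ B, a + η ≤ g x) : False := by
  obtain ⟨X₀, X₁, X₂, c₀, c₁, c₂, hc, hd, ha, hb, h₀, h₁⟩ := h
  have hA₀ : A ⊆ X₀ := by
    have := isPreconnected_iff_subset_of_disjoint_closed.1 hA X₀ (X₁ ∪ X₂) c₀ (c₁.union c₂)
      (fun x _ => hc x) (by
        ext x
        simp only [mem_inter_iff, mem_union, mem_empty_iff_false, iff_false]
        rintro ⟨hx, hx0, hx1 | hx2⟩
        · exact absurd (h₀ x hx0 hx1) (not_lt.2 (hAb x hx))
        · exact hd x hx0 hx2)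
    refine this.resolve_right fun hh => ?_
    rcases hh hp with hx1 | hx2
    · exact absurd (h₀ p (ha p hpa) hx1) (not_lt.2 (hAb p hp))
    · exact hd p (ha p hpa) hx2
  have hB₂ : B ⊆ X₂ := by
    have := isPreconnected_iff_subset_of_disjoint_closed.1 hB X₂ (X₀ ∪ X₁) c₂ (c₀.union c₁)
      (fun x _ => by have := hc x; simp only [mem_union]; tauto) (by
        ext x
        simp only [mem_inter_iff, mem_union, mem_empty_iff_false, iff_false]
        rintro ⟨hx, hx2, hx0 | hx1⟩
        · exact hd x hx0 hx2
        · exact absurd (h₁ x hx1 hx2) (not_lt.2 (hBa x hx)))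
    refine this.resolve_right fun hh => ?_
    rcases hh hq with hx0 | hx1
    · exact hd q hx0 (hb q hqb)
    · exact absurd (h₁ q hx1 (hb q hqb)) (not_lt.2 (hBa q hq))
  exact hd r (hA₀ hrA) (hB₂ hrB)

/-- For a splitting `C = A ∪ B` with `p` in `A` only and `q` in `B` only, a sufficiently fine `g`
keeps `g p` away from `g '' B` and `g q` away from `g '' A`. This is the configuration that
crookedness between levels near `g p` and `g q` excludes. -/
theorem isHereditarilyIndecomposable_of_hasCrookedMap {X : Type*} [UniformSpace X] [T2Space X]
    (h : ∀ V ∈ 𝓤 X, HasCrookedMap X V) : IsHereditarilyIndecomposable X := by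
  intro C hC A B hA hB hAB
  by_contra! hne
  obtain ⟨p, hpC, hpB⟩ : ∃ p ∈ C, p ∉ B := by
    by_contra! hh
    exact hne.2 (Subset.antisymm (hAB ▸ subset_union_right) hh)
  obtain ⟨q, hqC, hqA⟩ : ∃ q ∈ C, q ∉ A := by
    by_contra! hh
    exact hne.1 (Subset.antisymm (hAB ▸ subset_union_left) hh)
  have hpA : p ∈ A := by rw [← hAB] at hpC; exact hpC.resolve_right hpB
  have hqB : q ∈ B := by rw [← hAB] at hqC; exact hqC.resolve_left hqA
  obtain ⟨r, hrA, hrB⟩ : (A ∩ B).Nonempty := by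
    by_contra hh
    have := isPreconnected_iff_subset_of_disjoint_closed.1 hC.connected.isPreconnected A B
      hA.compact.isClosed hB.compact.isClosed hAB.ge
      (by rw [not_nonempty_iff_eq_empty.1 hh, inter_empty])
    rcases this with h1 | h1
    · exact hqA (h1 hqC)
    · exact hpB (h1 hpC)
  obtain ⟨V₁, hV₁, hV₁B⟩ : ∃ V ∈ 𝓤 X, ∀ y ∈ B, (p, y) ∉ V := by
    have : Bᶜ ∈ 𝓝 p := hB.compact.isClosed.isOpen_compl.mem_nhds hpB
    obtain ⟨V, hV, hVs⟩ := UniformSpace.mem_nhds_iff.1 this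
    exact ⟨V, hV, fun y hy hy' => hVs hy' hy⟩
  obtain ⟨V₂, hV₂, hV₂A⟩ : ∃ V ∈ 𝓤 X, ∀ y ∈ A, (q, y) ∉ V := by
    have : Aᶜ ∈ 𝓝 q := hA.compact.isClosed.isOpen_compl.mem_nhds hqA
    obtain ⟨V, hV, hVs⟩ := UniformSpace.mem_nhds_iff.1 this
    exact ⟨V, hV, fun y hy hy' => hVs hy' hy⟩
  obtain ⟨g, hg, η, hη, hgV, h0, hcr⟩ := h (V₁ ∩ V₂) (inter_mem hV₁ hV₂)
  have fB : ∀ y ∈ B, 2 * η < |g p - g y| := fun y hy => by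
    by_contra! hh
    exact hV₁B y hy (hgV _ _ hh).1
  have fA : ∀ y ∈ A, 2 * η < |g q - g y| := fun y hy => by
    by_contra! hh
    exact hV₂A y hy (hgV _ _ hh).2
  -- a connected set whose image keeps the distance `2 * η` from a value lies on one side of it
  have side : ∀ (D : Set X), IsPreconnected D → ∀ v : ℝ, (∀ y ∈ D, 2 * η < |v - g y|) →
      (∀ y ∈ D, v + 2 * η < g y) ∨ (∀ y ∈ D, g y < v - 2 * η) := by
    intro D hD v hv
    by_contra! hh
    obtain ⟨⟨y, hy, hy'⟩, z, hz, hz'⟩ := hh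
    have hyv : g y ≤ v := by
      have := hv y hy
      rcases lt_abs.1 this with h1 | h1 <;> linarith
    have hzv : v ≤ g z := by
      have := hv z hz
      rcases lt_abs.1 this with h1 | h1 <;> linarith
    obtain ⟨w, hw, hwv⟩ := hD.intermediate_value hy hz hg.continuousOn ⟨hyv, hzv⟩
    have := hv w hw
    rw [hwv, sub_self, abs_zero] at this
    linarith
  -- the main case, with the roles of `A` and `B` symmetric
  have main : ∀ (A B : Set X), IsPreconnected A → IsPreconnected B → ∀ p ∈ A, ∀ q ∈ B,
      r ∈ A → r ∈ B → (∀ y ∈ B, g p + 2 * η < g y) → (∀ y ∈ A, g y < g q - 2 * η) → False := by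
    intro A B hA hB p hp q hq hrA hrB hlB hlA
    -- The levels are `g p` rounded up and `g q` rounded down to the grid. Each rounding costs less
    -- than `η`, so the margin `2 * η` still leaves `η`.
    have e1 : g p ≤ ⌈g p / η⌉₊ * η := by
      rw [← div_le_iff₀ hη]; exact Nat.le_ceil _
    have e2 : (⌈g p / η⌉₊ : ℝ) * η < g p + η := by
      have := Nat.ceil_lt_add_one (a := g p / η) (by have := h0 p; positivity)
      calc (⌈g p / η⌉₊ : ℝ) * η < (g p / η + 1) * η := by gcongr
        _ = g p + η := by field_simp
    have e3 : (⌊g q / η⌋₊ : ℝ) * η ≤ g q := by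
      rw [← le_div_iff₀ hη]; exact Nat.floor_le (by have := h0 q; positivity)
    have e4 : g q - η < ⌊g q / η⌋₊ * η := by
      have := Nat.lt_floor_add_one (g q / η)
      have : g q / η * η < (⌊g q / η⌋₊ + 1) * η := by gcongr
      rw [div_mul_cancel₀ _ hη.ne'] at this
      linarith
    have e5 := hlB r hrB
    have e6 := hlA r hrA
    have hij : ⌈g p / η⌉₊ + 2 ≤ ⌊g q / η⌋₊ := by
      have : ((⌈g p / η⌉₊ + 1 : ℕ) : ℝ) < ⌊g q / η⌋₊ := by
        have : ((⌈g p / η⌉₊ + 1 : ℕ) : ℝ) * η < ⌊g q / η⌋₊ * η := by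
          push_cast; linarith
        exact lt_of_mul_lt_mul_right this hη.le
      have := Nat.cast_lt.1 this
      omega
    exact (hcr _ _ hij).not_connected_union hA hB hp hq hrA hrB e1 e3
      (fun x hx => by have := hlA x hx; linarith) (fun x hx => by have := hlB x hx; linarith)
  have hA' := hA.connected.isPreconnected
  have hB' := hB.connected.isPreconnected
  rcases side B hB' _ fB with h1 | h1 <;> rcases side A hA' _ fA with h2 | h2
  · have := h1 q hqB; have := h2 p hpA; linarith
  · exact main A B hA' hB' p hpA q hqB hrA hrB h1 h2
  · exact main B A hB' hA' q hqB p hpA hrB hrA h2 h1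
  · have := h1 q hqB; have := h2 p hpA; linarith

theorem isArcLike_of_hasCrookedMap {X : Type*} [UniformSpace X] [CompactSpace X]
    (h : ∀ V ∈ 𝓤 X, HasCrookedMap X V) : IsArcLike X := by
  intro V hV
  obtain ⟨g, hg, η, hη, hgV, h0, -⟩ := h V hV
  obtain ⟨M, hM⟩ := (isCompact_range hg).bddAbove
  have hM' : ∀ x, g x ≤ M := fun x => hM ⟨x, rfl⟩
  refine ⟨fun x => ⟨g x / (|M| + 1), by have := h0 x; positivity, ?_⟩, by fun_prop, ?_⟩
  · rw [div_le_one (by positivity)]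
    exact (hM' x).trans ((le_abs_self M).trans (by linarith))
  · intro x y hxy
    have h1 : g x / (|M| + 1) = g y / (|M| + 1) := congrArg Subtype.val hxy
    have h2 : g x = g y := by
      have : |M| + 1 ≠ 0 := by positivity
      field_simp at h1
      exact h1
    refine hgV _ _ ?_
    rw [h2, sub_self, abs_zero]; positivity

theorem isPseudoArc_of_hasCrookedMap {X : Type*} [UniformSpace X] [CompactSpace X]
    [ConnectedSpace X] [TopologicalSpace.MetrizableSpace X] [Nontrivial X]
    (h : ∀ V ∈ 𝓤 X, HasCrookedMap X V) : IsPseudoArc X :=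
  ⟨⟨inferInstance, inferInstance, inferInstance, inferInstance⟩, isArcLike_of_hasCrookedMap h,
    isHereditarilyIndecomposable_of_hasCrookedMap h⟩

/-! ### Folding paths -/

/-- The restriction of `G` to `[0, L]` folds over at each of its crossings from level `a` to level
`b` and back. -/
def IsFolded (G : ℝ → ℝ) (L a b : ℝ) : Prop :=
  ∃ Y₀ Y₁ Y₂ : Set ℝ, IsClosed Y₀ ∧ IsClosed Y₁ ∧ IsClosed Y₂ ∧
    Y₀ ⊆ Icc 0 L ∧ Y₁ ⊆ Icc 0 L ∧ Y₂ ⊆ Icc 0 L ∧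
    (∀ t ∈ Icc 0 L, t ∈ Y₀ ∨ t ∈ Y₁ ∨ t ∈ Y₂) ∧ 0 ∈ Y₀ ∧ (∀ t ∈ Y₀, t ∉ Y₂) ∧
    (∀ t ∈ Y₀, G t ≤ b) ∧ (∀ t ∈ Y₁, a ≤ G t ∧ G t ≤ b) ∧ (∀ t ∈ Y₂, a ≤ G t) ∧
    (∀ t ∈ Y₀, t ∈ Y₁ → G t = b) ∧ (∀ t ∈ Y₁, t ∈ Y₂ → G t = a)

/-- Folds already achieved survive reparametrization, so several functions can be folded one after
another. -/
theorem IsFolded.comp {G : ℝ → ℝ} {L a b : ℝ} (h : IsFolded G L a b) {c : ℝ → ℝ} {L' : ℝ}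
    (hL' : 0 ≤ L') (hc : Continuous c) (hc0 : c 0 = 0) (hm : MapsTo c (Icc 0 L') (Icc 0 L)) :
    IsFolded (G ∘ c) L' a b := by
  obtain ⟨Y₀, Y₁, Y₂, c₀, c₁, c₂, -, -, -, hcov, h0, hd, g0, g1, g2, g01, g12⟩ := h
  refine ⟨Icc 0 L' ∩ c ⁻¹' Y₀, Icc 0 L' ∩ c ⁻¹' Y₁, Icc 0 L' ∩ c ⁻¹' Y₂,
    isClosed_Icc.inter (c₀.preimage hc), isClosed_Icc.inter (c₁.preimage hc),
    isClosed_Icc.inter (c₂.preimage hc), inter_subset_left, inter_subset_left, inter_subset_left,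
    fun t ht => ?_, ⟨⟨le_rfl, hL'⟩, by rwa [mem_preimage, hc0]⟩, fun t ht ht' => hd _ ht.2 ht'.2,
    fun t ht => g0 _ ht.2, fun t ht => g1 _ ht.2, fun t ht => g2 _ ht.2,
    fun t ht ht' => g01 _ ht.2 ht'.2, fun t ht ht' => g12 _ ht.2 ht'.2⟩
  have := hcov _ (hm ht)
  simp only [mem_inter_iff, mem_preimage, ht, true_and]
  exact this

theorem isFolded_of_lt {G : ℝ → ℝ} {L a b : ℝ} (hL : 0 ≤ L) (h : ∀ t ∈ Icc 0 L, G t ≤ b) :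
    IsFolded G L a b :=
  ⟨Icc 0 L, ∅, ∅, isClosed_Icc, isClosed_empty, isClosed_empty, subset_rfl, empty_subset _,
    empty_subset _, fun t ht => Or.inl ht, ⟨le_rfl, hL⟩, by simp, h, by simp, by simp, by simp,
    by simp⟩

/-- Run to the first time `p` at level `b`, back to the last earlier time `s` at level `a`, and
forward to `p` again. On the rest `[p, L]` the function starts at `b`, so the same procedure applies
to `-G` with levels `-b`, `-a`. Each ascent from `a` to `b` uses up length at least `δ`, so `n`
bounds the number of rounds. -/
theorem exists_isFolded_of_osc {δ : ℝ} (n : ℕ) : ∀ (L : ℝ), 0 ≤ L → L ≤ n * δ →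
    ∀ (G : ℝ → ℝ) (a b : ℝ), a < b → Continuous G →
    (∀ x ∈ Icc 0 L, ∀ y ∈ Icc 0 L, |x - y| < δ → |G x - G y| < b - a) → G 0 ≤ a →
    ∃ (L' : ℝ) (c : ℝ → ℝ), 0 ≤ L' ∧ Continuous c ∧ c 0 = 0 ∧ c L' = L ∧
      MapsTo c (Icc 0 L') (Icc 0 L) ∧ IsFolded (G ∘ c) L' a b := by
  induction n with
  | zero =>
    intro L hL hLn G a b hab hG hosc h0
    have : L = 0 := by simp at hLn; linarith
    subst this
    refine ⟨0, id, le_rfl, continuous_id, rfl, rfl, mapsTo_id _, isFolded_of_lt le_rfl ?_⟩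
    intro t ht
    have : t = 0 := le_antisymm ht.2 ht.1
    subst this
    simpa using h0.trans hab.le
  | succ n ih =>
    intro L hL hLn G a b hab hG hosc h0
    by_cases hlow : ∀ t ∈ Icc 0 L, G t ≤ b
    · exact ⟨L, id, hL, continuous_id, rfl, rfl, mapsTo_id _, isFolded_of_lt hL hlow⟩
    push Not at hlow
    obtain ⟨t₀, ht₀, hGt₀⟩ := hlow
    -- the first time at level `b`
    obtain ⟨p, ⟨⟨hp0, hpL⟩, hGp⟩, hpmin⟩ : ∃ p, IsLeast (Icc 0 L ∩ G ⁻¹' {b}) p := by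
      refine (isCompact_Icc.inter_right (isClosed_singleton.preimage hG)).exists_isLeast ?_
      obtain ⟨x, hx, hxb⟩ := intermediate_value_Icc ht₀.1 hG.continuousOn
        ⟨h0.trans hab.le, hGt₀.le⟩
      exact ⟨x, ⟨hx.1, hx.2.trans ht₀.2⟩, hxb⟩
    have hGp : G p = b := hGp
    have hbelow : ∀ t ∈ Icc 0 p, G t ≤ b := by
      intro t ht
      by_contra! hh
      obtain ⟨x, hx, hxb⟩ := intermediate_value_Icc ht.1 hG.continuousOn
        ⟨h0.trans hab.le, hh.le⟩
      have := hpmin ⟨⟨hx.1, hx.2.trans (ht.2.trans hpL)⟩, hxb⟩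
      have : t = p := le_antisymm ht.2 (this.trans hx.2)
      rw [this, hGp] at hh
      exact lt_irrefl _ hh
    -- the last time before `p` at level `a`
    obtain ⟨s, ⟨⟨hs0, hsp⟩, hGs⟩, hsmax⟩ : ∃ s, IsGreatest (Icc 0 p ∩ G ⁻¹' {a}) s := by
      refine (isCompact_Icc.inter_right (isClosed_singleton.preimage hG)).exists_isGreatest ?_
      obtain ⟨x, hx, hxb⟩ := intermediate_value_Icc hp0 hG.continuousOn ⟨h0, hGp.ge.trans' hab.le⟩
      exact ⟨x, hx, hxb⟩
    have hGs : G s = a := hGs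
    have habove : ∀ t ∈ Icc s p, a ≤ G t := by
      intro t ht
      by_contra! hh
      obtain ⟨x, hx, hxb⟩ := intermediate_value_Icc ht.2 hG.continuousOn
        ⟨hh.le, hGp.ge.trans' hab.le⟩
      have := hsmax ⟨⟨hs0.trans (ht.1.trans hx.1), hx.2⟩, hxb⟩
      have : t = s := le_antisymm (hx.1.trans this) ht.1
      rw [this, hGs] at hh
      exact lt_irrefl _ hh
    have hpδ : δ ≤ p := by
      by_contra! hh
      have := hosc p ⟨hp0, hpL⟩ 0 ⟨le_rfl, hL⟩ (by rwa [sub_zero, abs_of_nonneg hp0])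
      rw [hGp, abs_lt] at this
      linarith
    obtain ⟨L₁, c₁, hL₁, hc₁, hc₁0, hc₁L, hm₁, Y₀, Y₁, Y₂, k₀, k₁, k₂, l₀, l₁, l₂, hcov, hY0, hd,
        g0, g1, g2, g01, g12⟩ :=
      ih (L - p) (by linarith) (by push_cast at hLn; linarith) (fun x => -G (p + x)) (-b) (-a)
        (by linarith) (by fun_prop)
        (fun x hx y hy hxy => by
          have := hosc (p + x) ⟨by linarith [hx.1], by linarith [hx.2]⟩ (p + y)
            ⟨by linarith [hy.1], by linarith [hy.2]⟩ (by rwa [add_sub_add_left_eq_sub])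
          rw [abs_lt] at this ⊢
          constructor <;> linarith [this.1, this.2])
        (by simp [hGp])
    -- `τ` is the length of the route from 0 to `p` to `s` to `p`. The min-max term below is this
    -- piecewise linear route, frozen after time `τ`, when `c₁` takes over.
    set τ : ℝ := p + 2 * (p - s) with hτ
    set c : ℝ → ℝ := fun t => max (min (min t τ) (2 * p - min t τ)) (min t τ - 2 * (p - s)) +
      c₁ (max (t - τ) 0) with hcdef
    have hτp : p ≤ τ := by linarith
    have c_lo : ∀ t ≤ p, c t = t := by
      intro t ht
      have e1 : min t τ = t := min_eq_left (by linarith)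
      have e2 : max (t - τ) 0 = 0 := max_eq_right (by linarith)
      simp only [hcdef, e1, e2, hc₁0]
      rw [min_eq_left (by linarith), max_eq_left (by linarith), add_zero]
    have c_mid : ∀ t, p ≤ t → t ≤ 2 * p - s → c t = 2 * p - t := by
      intro t ht ht'
      have e1 : min t τ = t := min_eq_left (by linarith)
      have e2 : max (t - τ) 0 = 0 := max_eq_right (by linarith)
      simp only [hcdef, e1, e2, hc₁0]
      rw [min_eq_right (by linarith), max_eq_left (by linarith), add_zero]
    have c_up : ∀ t, 2 * p - s ≤ t → t ≤ τ → c t = t - 2 * (p - s) := by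
      intro t ht ht'
      have e1 : min t τ = t := min_eq_left (by linarith)
      have e2 : max (t - τ) 0 = 0 := max_eq_right (by linarith)
      simp only [hcdef, e1, e2, hc₁0]
      rw [min_eq_right (by linarith), max_eq_right (by linarith), add_zero]
    have c_hi : ∀ t, τ ≤ t → c t = p + c₁ (t - τ) := by
      intro t ht
      have e1 : min t τ = τ := min_eq_right (by linarith)
      have e2 : max (t - τ) 0 = t - τ := max_eq_left (by linarith)
      simp only [hcdef, e1, e2]
      rw [min_eq_right (by linarith), max_eq_right (by linarith)]
      ring
    have m_lo : ∀ t, 0 ≤ t → t ≤ p → G (c t) ≤ b := fun t h1 h2 => by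
      rw [c_lo t h2]; exact hbelow t ⟨h1, h2⟩
    have m_mid : ∀ t, p ≤ t → t ≤ 2 * p - s → a ≤ G (c t) ∧ G (c t) ≤ b := fun t h1 h2 => by
      rw [c_mid t h1 h2]
      exact ⟨habove _ ⟨by linarith, by linarith⟩, hbelow _ ⟨by linarith, by linarith⟩⟩
    have m_up : ∀ t, 2 * p - s ≤ t → t ≤ τ → a ≤ G (c t) ∧ G (c t) ≤ b := fun t h1 h2 => by
      rw [c_up t h1 h2]
      exact ⟨habove _ ⟨by linarith, by linarith⟩, hbelow _ ⟨by linarith, by linarith⟩⟩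
    have hsub : Continuous fun t : ℝ => t - τ := by fun_prop
    -- the parameter `τ` lies in the piece `Y₀` of the tail only
    have only0 : ∀ t, τ ≤ t → t ≤ τ → (t - τ ∉ Y₁ ∧ t - τ ∉ Y₂) := by
      intro t h1 h2
      have : t - τ = 0 := by linarith
      rw [this]
      refine ⟨fun hh => ?_, hd 0 hY0⟩
      have := g01 0 hY0 hh
      simp only [comp_apply, hc₁0, add_zero, hGp] at this
      linarith
    -- The sign change swaps the outer pieces: the tail's `Y₂` is added to the new first piece and
    -- the tail's `Y₀` to the new last one.
    refine ⟨τ + L₁, c, by linarith, by fun_prop, c_lo 0 hp0, ?_, ?_,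
      Icc 0 p ∪ (fun t => t - τ) ⁻¹' Y₂, Icc p (2 * p - s) ∪ (fun t => t - τ) ⁻¹' Y₁,
      Icc (2 * p - s) τ ∪ (fun t => t - τ) ⁻¹' Y₀,
      isClosed_Icc.union (k₂.preimage hsub), isClosed_Icc.union (k₁.preimage hsub),
      isClosed_Icc.union (k₀.preimage hsub), ?_, ?_, ?_, ?_, ?_, ?_, ?_, ?_, ?_, ?_, ?_⟩
    · rw [c_hi _ (by linarith), add_sub_cancel_left, hc₁L]; ring
    · intro t ht
      rcases le_total t p with h1 | h1
      · rw [c_lo t h1]; exact ⟨ht.1, by linarith⟩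
      rcases le_total t (2 * p - s) with h2 | h2
      · rw [c_mid t h1 h2]; constructor <;> linarith
      rcases le_total t τ with h3 | h3
      · rw [c_up t h2 h3]; constructor <;> linarith
      · rw [c_hi t h3]
        have := hm₁ (x := t - τ) ⟨by linarith, by linarith [ht.2]⟩
        constructor <;> linarith [this.1, this.2]
    · rintro t (ht | ht)
      · constructor <;> linarith [ht.1, ht.2]
      · have := l₂ ht; constructor <;> linarith [this.1, this.2]
    · rintro t (ht | ht)
      · constructor <;> linarith [ht.1, ht.2]
      · have := l₁ ht; constructor <;> linarith [this.1, this.2]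
    · rintro t (ht | ht)
      · constructor <;> linarith [ht.1, ht.2]
      · have := l₀ ht; constructor <;> linarith [this.1, this.2]
    · intro t ht
      simp only [mem_union, mem_Icc, mem_preimage]
      rcases le_total t p with h1 | h1
      · exact Or.inl (Or.inl ⟨ht.1, h1⟩)
      rcases le_total t (2 * p - s) with h2 | h2
      · exact Or.inr (Or.inl (Or.inl ⟨h1, h2⟩))
      rcases le_total t τ with h3 | h3
      · exact Or.inr (Or.inr (Or.inl ⟨h2, h3⟩))
      · rcases hcov (t - τ) ⟨by linarith, by linarith [ht.2]⟩ with h | h | h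
        · exact Or.inr (Or.inr (Or.inr h))
        · exact Or.inr (Or.inl (Or.inr h))
        · exact Or.inl (Or.inr h)
    · exact Or.inl ⟨le_rfl, hp0⟩
    · rintro t (ht | ht) (ht' | ht')
      · have : p = s := by linarith [ht.2, ht'.1]
        rw [this, hGs] at hGp; linarith
      · have h1 := (l₀ ht').1
        have : p = s := by linarith [ht.2]
        rw [this, hGs] at hGp; linarith
      · exact (only0 t (by linarith [(l₂ ht).1]) ht'.2).2 ht
      · exact hd _ ht' ht
    · rintro t (ht | ht)
      · exact m_lo t ht.1 ht.2
      · have := g2 _ ht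
        simp only [comp_apply] at this
        rw [comp_apply, c_hi t (by linarith [(l₂ ht).1])]
        linarith
    · rintro t (ht | ht)
      · exact m_mid t ht.1 ht.2
      · have := g1 _ ht
        simp only [comp_apply] at this
        rw [comp_apply, c_hi t (by linarith [(l₁ ht).1])]
        constructor <;> linarith
    · rintro t (ht | ht)
      · exact (m_up t ht.1 ht.2).1
      · have := g0 _ ht
        simp only [comp_apply] at this
        rw [comp_apply, c_hi t (by linarith [(l₀ ht).1])]
        linarith
    · rintro t (ht | ht) (ht' | ht')
      · have : t = p := le_antisymm ht.2 ht'.1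
        rw [comp_apply, c_lo t ht.2, this, hGp]
      · have h1 := (l₁ ht').1
        exact absurd ht' (only0 t (by linarith) (by linarith [ht.2])).1
      · exact absurd ht (only0 t (by linarith [(l₂ ht).1]) (by linarith [ht'.2])).2
      · have := g12 _ ht' ht
        simp only [comp_apply] at this
        rw [comp_apply, c_hi t (by linarith [(l₂ ht).1])]
        linarith
    · rintro t (ht | ht) (ht' | ht')
      · have : t = 2 * p - s := le_antisymm ht.2 ht'.1
        rw [comp_apply, c_mid t ht.1 ht.2, this, ← hGs]
        congr 1; ring
      · have h1 := (l₀ ht').1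
        have : p = s := by linarith [ht.2]
        rw [this, hGs] at hGp; linarith
      · exact absurd ht (only0 t (by linarith [(l₁ ht).1]) ht'.2).1
      · have := g01 _ ht' ht
        simp only [comp_apply] at this
        rw [comp_apply, c_hi t (by linarith [(l₁ ht).1])]
        linarith

theorem exists_isFolded {G : ℝ → ℝ} (hG : Continuous G) {a b L : ℝ} (hab : a < b) (hL : 0 ≤ L)
    (h0 : G 0 ≤ a) : ∃ (L' : ℝ) (c : ℝ → ℝ), 0 ≤ L' ∧ Continuous c ∧ c 0 = 0 ∧ c L' = L ∧
      MapsTo c (Icc 0 L') (Icc 0 L) ∧ IsFolded (G ∘ c) L' a b := by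
  have huc := isCompact_Icc.uniformContinuousOn_of_continuous (s := Icc 0 L) hG.continuousOn
  obtain ⟨δ, hδ, hosc⟩ := Metric.uniformContinuousOn_iff.1 huc (b - a) (by linarith)
  obtain ⟨n, hn⟩ := exists_nat_ge (L / δ)
  exact exists_isFolded_of_osc n L hL ((div_le_iff₀ hδ).1 hn) G a b hab hG hosc h0

/-- A single path that folds finitely many functions. -/
theorem exists_isFolded_finite {ι : Type*} (s : Finset ι) {G : ι → ℝ → ℝ}
    (hG : ∀ i ∈ s, Continuous (G i)) {a b L : ℝ} (hab : a < b) (hL : 0 ≤ L)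
    (h0 : ∀ i ∈ s, G i 0 ≤ a) :
    ∃ (L' : ℝ) (c : ℝ → ℝ), 0 ≤ L' ∧ Continuous c ∧ c 0 = 0 ∧ c L' = L ∧
      MapsTo c (Icc 0 L') (Icc 0 L) ∧ ∀ i ∈ s, IsFolded (G i ∘ c) L' a b := by
  classical
  induction s using Finset.induction_on with
  | empty => exact ⟨L, id, hL, continuous_id, rfl, rfl, mapsTo_id _, by simp⟩
  | insert i s _ ih =>
    obtain ⟨L₁, c₁, hL₁, hc₁, h₁0, h₁L, hm₁, hf₁⟩ :=
      ih (fun j hj => hG j (Finset.mem_insert_of_mem hj))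
        (fun j hj => h0 j (Finset.mem_insert_of_mem hj))
    have hi := Finset.mem_insert_self i s
    obtain ⟨L₂, c₂, hL₂, hc₂, h₂0, h₂L, hm₂, hf₂⟩ :=
      exists_isFolded (G := G i ∘ c₁) ((hG i hi).comp hc₁) hab hL₁
        (by simpa [h₁0] using h0 i hi)
    refine ⟨L₂, c₁ ∘ c₂, hL₂, hc₁.comp hc₂, by simp [h₁0, h₂0], by simp [h₁L, h₂L],
      hm₁.comp hm₂, fun j hj => ?_⟩
    rcases Finset.mem_insert.1 hj with rfl | hj
    · exact hf₂
    · exact (hf₁ j hj).comp hL₂ hc₂ h₂0 hm₂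

/-! ### Maps of the plane that lift through all power maps -/

/-- An injective map of the plane of the form `z ↦ z * exp (κ z)`. -/
structure ExpMap where
  κ : ℂ → ℂ
  continuousOn : ContinuousOn κ {0}ᶜ
  bounded : ∃ M : ℝ, ∀ z, (κ z).re ≤ M
  inj : Injective fun z => z * Complex.exp (κ z)
  one : κ 1 = 0

namespace ExpMap

/-- The underlying map of the plane. -/
noncomputable def map (e : ExpMap) (z : ℂ) : ℂ := z * Complex.exp (e.κ z)

/-- The lift of the underlying map through `z ↦ z ^ N`. -/
noncomputable def lift (e : ExpMap) (N : ℕ) (z : ℂ) : ℂ := z * Complex.exp (e.κ (z ^ N) / N)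

@[simp] theorem map_zero (e : ExpMap) : e.map 0 = 0 := by simp [map]

@[simp] theorem lift_zero (e : ExpMap) (N : ℕ) : e.lift N 0 = 0 := by simp [lift]

@[simp] theorem map_one (e : ExpMap) : e.map 1 = 1 := by simp [map, e.one]

@[simp] theorem lift_one (e : ExpMap) (N : ℕ) : e.lift N 1 = 1 := by simp [lift, e.one]

theorem lift_eq_map (e : ExpMap) : e.lift 1 = e.map := by
  ext z; simp [lift, map]

theorem lift_pow (e : ExpMap) {N : ℕ} (hN : N ≠ 0) (z : ℂ) :
    e.lift N z ^ N = e.map (z ^ N) := by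
  have : (N : ℂ) ≠ 0 := by exact_mod_cast hN
  rw [lift, map, mul_pow, ← Complex.exp_nat_mul, mul_div_cancel₀ _ this]

/-- The exponential factor depends on `z` only through `z ^ N`, which is recovered from the `N`-th
power of the lift by injectivity downstairs. -/
theorem injective_lift (e : ExpMap) {N : ℕ} (hN : N ≠ 0) : Injective (e.lift N) := by
  intro z w h
  have h1 : z ^ N = w ^ N := e.inj (by
    have := congrArg (· ^ N) h
    simp only [lift_pow e hN] at this
    exact this)
  rw [lift, lift, h1] at h
  exact mul_right_cancel₀ (Complex.exp_ne_zero _) h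

theorem continuous_lift (e : ExpMap) {N : ℕ} (hN : N ≠ 0) : Continuous (e.lift N) := by
  rw [continuous_iff_continuousAt]
  intro z
  by_cases hz : z = 0
  · subst hz
    -- At 0 the function `κ` may be discontinuous; the upper bound on its real part suffices.
    obtain ⟨M, hM⟩ := e.bounded
    rw [ContinuousAt, lift_zero, tendsto_zero_iff_norm_tendsto_zero]
    refine squeeze_zero (fun _ => norm_nonneg _) (g := fun z : ℂ => ‖z‖ * Real.exp (M / N))
      (fun z => ?_) ?_
    · rw [lift, norm_mul, Complex.norm_exp]
      gcongr
      rw [Complex.div_natCast_re]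
      gcongr
      exact hM _
    · have : Continuous fun z : ℂ => ‖z‖ * Real.exp (M / N) := by fun_prop
      simpa using this.tendsto 0
  · have h1 : ContinuousAt e.κ (z ^ N) :=
      e.continuousOn.continuousAt (isOpen_compl_singleton.mem_nhds (pow_ne_zero _ hz))
    have h2 : ContinuousAt (fun z => e.κ (z ^ N)) z :=
      h1.comp (f := fun z : ℂ => z ^ N) (continuous_pow N).continuousAt
    exact continuousAt_id.mul (Complex.continuous_exp.continuousAt.comp (h2.div_const _))

/-- The composition `h ∘ e`. -/
noncomputable def comp (h e : ExpMap) : ExpMap where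
  κ z := e.κ z + h.κ (e.map z)
  continuousOn := by
    refine e.continuousOn.add (h.continuousOn.comp ?_ fun z hz => ?_)
    · rw [← lift_eq_map]; exact (e.continuous_lift one_ne_zero).continuousOn
    · exact mul_ne_zero hz (Complex.exp_ne_zero _)
  bounded := by
    obtain ⟨M, hM⟩ := e.bounded
    obtain ⟨M', hM'⟩ := h.bounded
    exact ⟨M + M', fun z => by rw [Complex.add_re]; exact add_le_add (hM _) (hM' _)⟩
  inj := by
    have : (fun z => z * Complex.exp (e.κ z + h.κ (e.map z))) =
        (fun z => z * Complex.exp (h.κ z)) ∘ (fun z => z * Complex.exp (e.κ z)) := by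
      ext z
      simp only [comp_apply, map, Complex.exp_add, mul_assoc]
    rw [this]
    exact h.inj.comp e.inj
  one := by simp [e.one, h.one]

theorem comp_map (h e : ExpMap) (z : ℂ) : (h.comp e).map z = h.map (e.map z) := by
  simp only [map, comp, Complex.exp_add, mul_assoc]

theorem comp_lift (h e : ExpMap) {N : ℕ} (hN : N ≠ 0) (z : ℂ) :
    (h.comp e).lift N z = h.lift N (e.lift N z) := by
  rw [lift.eq_1 h, lift_pow e hN]
  simp only [lift, comp, add_div, Complex.exp_add, mul_assoc]

/-- The identity. -/
def identity : ExpMap where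
  κ _ := 0
  continuousOn := continuousOn_const
  bounded := ⟨0, fun _ => le_rfl⟩
  inj := fun z w h => by simpa using h
  one := rfl

/-- The map sends the closed unit disk into itself. -/
def MapsDisk (e : ExpMap) : Prop := ∀ z, ‖z‖ ≤ 1 → ‖e.map z‖ ≤ 1

theorem MapsDisk.comp {h e : ExpMap} (hh : h.MapsDisk) (he : e.MapsDisk) :
    (h.comp e).MapsDisk := fun z hz => by
  rw [comp_map]; exact hh _ (he _ hz)

theorem mapsDisk_identity : identity.MapsDisk := fun z hz => by simpa [map, identity] using hz

theorem MapsDisk.norm_lift_le {e : ExpMap} (he : e.MapsDisk) {N : ℕ} (hN : N ≠ 0) {z : ℂ}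
    (hz : ‖z‖ ≤ 1) : ‖e.lift N z‖ ≤ 1 := by
  have h1 : ‖e.lift N z‖ ^ N ≤ 1 := by
    rw [← norm_pow, lift_pow e hN]
    exact he _ (by rw [norm_pow]; exact pow_le_one₀ (norm_nonneg _) hz)
  exact (pow_le_one_iff_of_nonneg (norm_nonneg _) hN).1 h1

/-- The lift commutes with multiplication by `N`-th roots of unity, and a point over the image
differs only by such a root from the lift of an `N`-th root upstairs. -/
theorem image_lift (e : ExpMap) {N : ℕ} (hN : N ≠ 0) :
    e.lift N '' Metric.closedBall 0 1 =
      {w : ℂ | w ^ N ∈ e.map '' Metric.closedBall 0 1} := by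
  ext w
  constructor
  · rintro ⟨z, hz, rfl⟩
    rw [mem_closedBall_zero_iff] at hz
    refine ⟨z ^ N, ?_, (lift_pow e hN z).symm⟩
    rw [mem_closedBall_zero_iff, norm_pow]
    exact pow_le_one₀ (norm_nonneg _) hz
  · rintro ⟨y, hy, hyw⟩
    rw [mem_closedBall_zero_iff] at hy
    obtain ⟨z, hz⟩ := IsAlgClosed.exists_pow_nat_eq y (Nat.pos_of_ne_zero hN)
    have hz1 : ‖z‖ ≤ 1 := by
      rw [← hz, norm_pow] at hy
      exact (pow_le_one_iff_of_nonneg (norm_nonneg _) hN).1 hy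
    have hpow : e.lift N z ^ N = w ^ N := by rw [lift_pow e hN, hz, hyw]
    by_cases h0 : e.lift N z = 0
    · rw [h0, zero_pow hN] at hpow
      refine ⟨0, by simp, ?_⟩
      rw [lift_zero]
      exact ((pow_eq_zero_iff hN).1 hpow.symm).symm
    · set ω := w / e.lift N z with hω
      have hω1 : ω ^ N = 1 := by
        rw [hω, div_pow, hpow, div_self]
        rw [← hpow]; exact pow_ne_zero _ h0
      have hωn : ‖ω‖ = 1 := by
        have : ‖ω‖ ^ N = 1 := by rw [← norm_pow, hω1, norm_one]
        exact (pow_eq_one_iff_of_nonneg (norm_nonneg _) hN).1 this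
      refine ⟨ω * z, by rw [mem_closedBall_zero_iff, norm_mul, hωn, one_mul]; exact hz1, ?_⟩
      have : e.lift N (ω * z) = ω * e.lift N z := by
        rw [lift, lift, mul_pow, hω1, one_mul, mul_assoc]
      rw [this, hω, div_mul_cancel₀ _ h0]

/-- The map that rescales each ray by a factor depending on its direction. -/
noncomputable def radial (C : ℂ → ℝ) (hC : ContinuousOn C (Metric.sphere 0 1))
    (hb : ∃ M : ℝ, ∀ z, C z ≤ M) (h1 : C 1 = 0) : ExpMap where
  κ z := C (z / ‖z‖)
  continuousOn := by
    refine Complex.continuous_ofReal.comp_continuousOn (hC.comp ?_ fun z hz => ?_)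
    · refine continuousOn_id.div (by fun_prop) fun z hz => ?_
      simpa using hz
    · have : ‖z‖ ≠ 0 := by simpa using hz
      rw [mem_sphere_zero_iff_norm, norm_div, Complex.norm_real, norm_norm, div_self this]
  bounded := by
    obtain ⟨M, hM⟩ := hb
    exact ⟨M, fun z => by rw [Complex.ofReal_re]; exact hM _⟩
  inj := by
    intro z w h
    simp only [← Complex.ofReal_exp] at h
    have key : ∀ (z : ℂ) (r : ℝ), 0 < r → (z * r) / ‖z * r‖ = z / ‖z‖ := fun z r hr => by
      rw [norm_mul, Complex.norm_real, Real.norm_of_nonneg hr.le, Complex.ofReal_mul,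
        mul_div_mul_right _ _ (by exact_mod_cast hr.ne')]
    have h2 : z / ‖z‖ = w / ‖w‖ := by
      rw [← key z _ (Real.exp_pos (C (z / ‖z‖))), h, key w _ (Real.exp_pos _)]
    rw [h2] at h
    exact mul_right_cancel₀ (by exact_mod_cast (Real.exp_pos _).ne') h
  one := by simp [h1]

/-- The map that rotates each circle around the origin by an angle depending on the logarithm of
its radius. -/
noncomputable def twist (τ : ℝ → ℝ) (hτ : Continuous τ) (h0 : τ 0 = 0) : ExpMap where
  κ z := τ (Real.log ‖z‖) * Complex.I
  continuousOn := by
    refine ContinuousOn.mul (Complex.continuous_ofReal.comp_continuousOn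
      (hτ.comp_continuousOn ?_)) continuousOn_const
    exact ContinuousOn.log (by fun_prop) fun z hz => by simpa using hz
  bounded := ⟨0, fun z => by simp⟩
  inj := by
    intro z w h
    have key : ∀ z : ℂ, ‖z * Complex.exp (τ (Real.log ‖z‖) * Complex.I)‖ = ‖z‖ := fun z => by
      rw [norm_mul, Complex.norm_exp_ofReal_mul_I, mul_one]
    have h2 : ‖z‖ = ‖w‖ := by
      rw [← key z, ← key w]; exact congrArg norm h
    simp only [h2] at h
    exact mul_right_cancel₀ (Complex.exp_ne_zero _) h
  one := by simp [h0]

/-- The map that squeezes the plane towards the positive real axis. -/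
noncomputable def squeeze (K : ℝ) (hK : 0 ≤ K) : ExpMap :=
  radial (fun ζ => -(K * ‖ζ - 1‖)) (by fun_prop) ⟨0, fun z => by
    have := mul_nonneg hK (norm_nonneg (z - 1)); linarith⟩ (by simp)

/-- The logarithm of the absolute value of `squeeze K z`. -/
noncomputable def height (K : ℝ) (z : ℂ) : ℝ := Real.log ‖z‖ - K * ‖z / ‖z‖ - 1‖

theorem norm_squeeze_map {K : ℝ} (hK : 0 ≤ K) (z : ℂ) :
    ‖(squeeze K hK).map z‖ = ‖z‖ * Real.exp (-(K * ‖z / ‖z‖ - 1‖)) := by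
  rw [map, norm_mul, Complex.norm_exp]
  simp [squeeze, radial]

theorem log_norm_squeeze_map {K : ℝ} (hK : 0 ≤ K) {z : ℂ} (hz : z ≠ 0) :
    Real.log ‖(squeeze K hK).map z‖ = height K z := by
  rw [norm_squeeze_map, Real.log_mul (norm_ne_zero_iff.2 hz) (Real.exp_ne_zero _), Real.log_exp,
    height]
  ring

theorem height_le {K : ℝ} {z : ℂ} (h1 : ‖z‖ ≤ 1) :
    height K z ≤ -(K * ‖z / ‖z‖ - 1‖) := by
  rw [height]
  have := Real.log_nonpos (norm_nonneg z) h1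
  linarith

theorem continuous_map (e : ExpMap) : Continuous e.map := by
  rw [← lift_eq_map]; exact e.continuous_lift one_ne_zero

/-- Turns estimates in logarithmic polar coordinates into distances inside the disk. -/
theorem norm_exp_sub_exp_le {a b : ℂ} (ha : a.re ≤ 0) (hb : b.re ≤ 0) :
    ‖Complex.exp a - Complex.exp b‖ ≤ ‖a - b‖ := by
  have hs : Convex ℝ {z : ℂ | z.re ≤ 0} := convex_halfSpace_re_le 0
  have := hs.norm_image_sub_le_of_norm_hasDerivWithin_le (f := Complex.exp) (f' := Complex.exp)
    (C := 1) (x := b) (y := a) (fun x _ => (Complex.hasDerivAt_exp x).hasDerivWithinAt)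
    (fun x hx => by rw [Complex.norm_exp]; exact Real.exp_le_one_iff.2 hx) hb ha
  simpa using this

end ExpMap

/-! ### Tightly wound spirals. -/

namespace ExpMap

/-- Logarithmic polar coordinates for the lift. The free unit factor `u` lets the branch cut of
`arg` be rotated to a harmless place. -/
theorem lift_mul_eq_exp (e : ExpMap) {N : ℕ} (hN : N ≠ 0) {z u : ℂ} (hz : z ≠ 0) (hu : ‖u‖ = 1) :
    e.lift N z * u =
      Complex.exp ((Real.log ‖z ^ N‖ + e.κ (z ^ N) + N * Complex.arg (z * u) * Complex.I) / N) := by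
  have hN' : (N : ℂ) ≠ 0 := by exact_mod_cast hN
  have hu0 : u ≠ 0 := by rw [← norm_ne_zero_iff, hu]; exact one_ne_zero
  have h1 : z * u = Complex.exp (Real.log ‖z‖ + Complex.arg (z * u) * Complex.I) := by
    conv_lhs => rw [← Complex.exp_log (mul_ne_zero hz hu0), Complex.log]
    rw [norm_mul, hu, mul_one]
  rw [lift, mul_right_comm, h1, ← Complex.exp_add, ← h1, norm_pow, Real.log_pow]
  congr 1
  push_cast
  field_simp
  ring

theorem height_ofReal_neg {K r : ℝ} (hr : 0 < r) : height K (-r : ℂ) = Real.log r - 2 * K := by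
  have h0 : ((r : ℝ) : ℂ) ≠ 0 := by exact_mod_cast hr.ne'
  rw [height, norm_neg, Complex.norm_real, Real.norm_of_nonneg hr.le, neg_div, div_self h0]
  norm_num
  ring

/-- A map that winds the disk into a thin spiral: its lift has image close to an arc. -/
theorem exists_spiral {N : ℕ} (hN : N ≠ 0) {ε : ℝ} (hε : 0 < ε) :
    ∃ e : ExpMap, e.MapsDisk ∧ ∃ g : ℂ → ℝ, ContinuousOn g (Metric.closedBall 0 1) ∧
      (∀ z, 0 ≤ g z) ∧ g 0 = 0 ∧ ∃ η > 0, ∀ z w : ℂ, ‖z‖ ≤ 1 → ‖w‖ ≤ 1 →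
        |g z - g w| ≤ 2 * η → ‖e.lift N z - e.lift N w‖ < ε := by
  have hN' : (0 : ℝ) < N := by exact_mod_cast Nat.pos_of_ne_zero hN
  have hN1 : (1 : ℝ) ≤ N := by exact_mod_cast Nat.one_le_iff_ne_zero.2 hN
  have hNC : (N : ℂ) ≠ 0 := by exact_mod_cast hN
  -- The squeeze of strength `M` leaves `N` arms upstairs, and a twist of rate `B` winds them around
  -- the origin. Up to scaling and shift, `g` is the unwrapped angle along the spiral, so equal `g`
  -- means equal direction, and heights differ by at most `2πN / B`. `M` is such that heights below
  -- `1 - M` land within `ε / 4` of the origin.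
  set M : ℝ := 1 + N * |Real.log (ε / 4)| with hM
  have hM1 : 1 ≤ M := by rw [hM]; have := abs_nonneg (Real.log (ε / 4)); nlinarith
  have hM0 : 0 ≤ M := by linarith
  have hMε : ∀ t ≤ 1 - M, Real.exp (t / N) ≤ ε / 4 := by
    intro t ht
    rw [← Real.le_log_iff_exp_le (by positivity), div_le_iff₀ hN']
    have := neg_abs_le (Real.log (ε / 4))
    nlinarith
  set η : ℝ := min 1 (ε / 8) with hη
  have hη0 : 0 < η := by positivity
  have hη1 : η ≤ 1 := min_le_left _ _
  have hη2 : η ≤ ε / 8 := min_le_right _ _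
  set B : ℝ := (2 * Real.pi * N + 4) * max 1 (4 / ε) with hB
  have hpi := Real.pi_pos
  have hB0 : 0 < B := by positivity
  have hB1 : 2 * Real.pi * N + 4 ≤ B := le_mul_of_one_le_right (by positivity) (le_max_left _ _)
  have hB2 : 2 * Real.pi * N + 4 ≤ B * (ε / 4) := by
    have : (1 : ℝ) ≤ max 1 (4 / ε) * (ε / 4) := by
      calc (1 : ℝ) = 4 / ε * (ε / 4) := by field_simp
        _ ≤ _ := by gcongr; exact le_max_right _ _
    rw [hB, mul_assoc (2 * Real.pi * N + 4)]
    exact le_mul_of_one_le_right (by positivity) this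
  set τ : ℝ → ℝ := fun t => B * max t (-M) with hτ
  set e : ExpMap := (twist τ (by fun_prop) (by simp [hτ, hM0])).comp (squeeze M hM0) with he
  have hκ : ∀ v : ℂ, v ≠ 0 → Real.log ‖v‖ + e.κ v = height M v + τ (height M v) * Complex.I := by
    intro v hv
    have h1 : e.κ v = (-(M * ‖v / ‖v‖ - 1‖) : ℝ) +
        τ (Real.log ‖(squeeze M hM0).map v‖) * Complex.I := rfl
    rw [h1, log_norm_squeeze_map hM0 hv, ← add_assoc, ← Complex.ofReal_add, ← sub_eq_add_neg,
      ← height]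
  -- The cut of `arg (z * u)` lies where `arg z = π / N`. There `z ^ N` is negative and its height
  -- is at most `-2 * M`, inside the region where `g` is set to 0.
  set u : ℂ := -Complex.exp (-(Real.pi / N * Complex.I)) with hu
  have hun : ‖u‖ = 1 := by
    rw [hu, norm_neg, Complex.norm_exp]
    simp
  have hlift : ∀ z : ℂ, z ≠ 0 → e.lift N z * u = Complex.exp ((height M (z ^ N) +
      (τ (height M (z ^ N)) + N * Complex.arg (z * u) : ℝ) * Complex.I) / N) := by
    intro z hz
    rw [lift_mul_eq_exp e hN hz hun, hκ _ (pow_ne_zero _ hz)]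
    congr 2
    push_cast
    ring
  have hnorm : ∀ z : ℂ, z ≠ 0 → ‖e.lift N z‖ = Real.exp (height M (z ^ N) / N) := by
    intro z hz
    rw [← mul_one ‖e.lift N z‖, ← hun, ← norm_mul, hlift z hz, Complex.norm_exp,
      Complex.div_natCast_re]
    simp
  have hheight : ∀ z : ℂ, ‖z‖ ≤ 1 → height M (z ^ N) ≤ 0 := fun z hz => by
    have h1 : ‖z ^ N‖ ≤ 1 := by rw [norm_pow]; exact pow_le_one₀ (norm_nonneg _) hz
    have := mul_nonneg hM0 (norm_nonneg (z ^ N / ‖z ^ N‖ - 1))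
    linarith [height_le (K := M) h1]
  have hdisk : e.MapsDisk := by
    intro z hz
    rw [he, comp_map, map.eq_1 (twist _ _ _), norm_mul, norm_squeeze_map]
    have : ‖Complex.exp ((twist τ (by fun_prop) (by simp [hτ, hM0])).κ
        ((squeeze M hM0).map z))‖ = 1 := Complex.norm_exp_ofReal_mul_I _
    rw [this, mul_one]
    refine mul_le_one₀ hz (Real.exp_pos _).le (Real.exp_le_one_iff.2 ?_)
    have := mul_nonneg hM0 (norm_nonneg (z / ‖z‖ - 1))
    linarith
  -- the modulus after squeezing
  set m : ℂ → ℝ := fun z => ‖(squeeze M hM0).map (z ^ N)‖ with hm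
  have hmc : Continuous m := ((continuous_map _).comp (continuous_pow N)).norm
  have hlogm : ∀ z : ℂ, z ≠ 0 → Real.log (m z) = height M (z ^ N) := fun z hz =>
    log_norm_squeeze_map hM0 (pow_ne_zero _ hz)
  have hm0 : ∀ z, Real.exp (-M) ≤ m z → z ≠ 0 := by
    rintro z hz rfl
    have : m 0 = 0 := by simp [hm, zero_pow hN]
    rw [this] at hz
    exact absurd hz (not_le.2 (Real.exp_pos _))
  have hmM : ∀ z, z ≠ 0 → (Real.exp (-M) ≤ m z ↔ -M ≤ height M (z ^ N)) := fun z hz => by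
    rw [← hlogm z hz, Real.le_log_iff_exp_le]
    exact norm_pos_iff.2 (mul_ne_zero (pow_ne_zero _ hz) (Complex.exp_ne_zero _))
  -- Subtracting `π * N` makes `F` vanish at height `-M`, because `arg ≤ π`; the extension by 0
  -- towards the origin is therefore continuous.
  set F : ℂ → ℝ := fun z =>
    max (B * M + B * Real.log (m z) + N * Complex.arg (z * u) - Real.pi * N) 0 with hF
  set g : ℂ → ℝ := fun z => if Real.exp (-M) ≤ m z then F z else 0 with hg
  have hFc : ContinuousOn F (Metric.closedBall 0 1 ∩ {z | Real.exp (-M) ≤ m z}) := by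
    have h1 : ContinuousOn (fun z => Real.log (m z))
        (Metric.closedBall 0 1 ∩ {z | Real.exp (-M) ≤ m z}) :=
      hmc.continuousOn.log fun z hz => ((Real.exp_pos _).trans_le hz.2).ne'
    have h2 : ContinuousOn (fun z => Complex.arg (z * u))
        (Metric.closedBall 0 1 ∩ {z | Real.exp (-M) ≤ m z}) := by
      rintro z ⟨hz1, hz⟩
      rw [mem_closedBall_zero_iff] at hz1
      have hz0 := hm0 z hz
      have hzM := (hmM z hz0).1 hz
      refine ContinuousAt.continuousWithinAt (ContinuousAt.comp (g := Complex.arg)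
        (f := fun z => z * u) (Complex.continuousAt_arg ?_) (by fun_prop))
      by_contra hns
      have hu0 : u ≠ 0 := by rw [← norm_ne_zero_iff, hun]; exact one_ne_zero
      rw [Complex.mem_slitPlane_iff_arg] at hns
      have harg : Complex.arg (z * u) = Real.pi := by
        by_contra h'
        exact hns ⟨h', mul_ne_zero hz0 hu0⟩
      have h3 : z * u = -‖z‖ := by
        have := Complex.norm_mul_exp_arg_mul_I (z * u)
        rw [harg, Complex.exp_pi_mul_I, norm_mul, hun, mul_one] at this
        rw [← this]; ring
      have h4 : z = ‖z‖ * Complex.exp (Real.pi / N * Complex.I) := by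
        rw [hu, mul_neg, neg_inj] at h3
        rw [← h3, mul_assoc, ← Complex.exp_add, neg_add_cancel, Complex.exp_zero, mul_one]
      have h5 : z ^ N = -((‖z‖ ^ N : ℝ) : ℂ) := by
        conv_lhs => rw [h4, mul_pow, ← Complex.exp_nat_mul]
        have : (N : ℂ) * (Real.pi / N * Complex.I) = Real.pi * Complex.I := by field_simp
        rw [this, Complex.exp_pi_mul_I]
        push_cast; ring
      have hzp : 0 < ‖z‖ ^ N := pow_pos (norm_pos_iff.2 hz0) _
      rw [h5, height_ofReal_neg hzp] at hzM
      have := Real.log_nonpos hzp.le (pow_le_one₀ (norm_nonneg _) hz1)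
      linarith
    exact ((((continuousOn_const).add (continuousOn_const.mul h1)).add
      (continuousOn_const.mul h2)).sub continuousOn_const).sup continuousOn_const
  have hFlow : ∀ z, z ≠ 0 → height M (z ^ N) = -M → F z = 0 := by
    intro z hz h
    have := Complex.arg_le_pi (z * u)
    rw [hF]
    refine max_eq_right ?_
    rw [hlogm z hz, h]
    nlinarith
  have hgc : ContinuousOn g (Metric.closedBall 0 1) := by
    have e1 : Metric.closedBall (0 : ℂ) 1 = (Metric.closedBall 0 1 ∩ {z | Real.exp (-M) ≤ m z}) ∪
        (Metric.closedBall 0 1 ∩ {z | m z ≤ Real.exp (-M)}) := by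
      rw [← inter_union_distrib_left, eq_comm, inter_eq_left]
      exact fun z _ => le_total (Real.exp (-M)) (m z)
    rw [e1]
    refine ContinuousOn.union_of_isClosed (hFc.congr fun z hz => if_pos hz.2)
      ((continuousOn_const (c := (0 : ℝ))).congr fun z hz => ?_)
      (Metric.isClosed_closedBall.inter (isClosed_le continuous_const hmc))
      (Metric.isClosed_closedBall.inter (isClosed_le hmc continuous_const))
    by_cases h : Real.exp (-M) ≤ m z
    · have hz0 := hm0 z h
      refine (if_pos h).trans (hFlow z hz0 ?_)
      rw [← hlogm z hz0, le_antisymm hz.2 h, Real.log_exp]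
    · exact if_neg h
  have hg0 : ∀ z, 0 ≤ g z := fun z => by
    rw [hg]
    dsimp only
    split_ifs
    · exact le_max_right _ _
    · exact le_rfl
  -- points with small values of `g` are close to the origin
  have hsmall : ∀ z, ‖z‖ ≤ 1 → g z ≤ 2 * η → ‖e.lift N z‖ ≤ ε / 4 := by
    intro z hz1 hz
    by_cases hz0 : z = 0
    · rw [hz0, lift_zero, norm_zero]; positivity
    rw [hnorm z hz0]
    apply hMε
    by_cases h : Real.exp (-M) ≤ m z
    · have h1 : g z = F z := if_pos h
      rw [h1, hF] at hz
      have h2 := (le_max_left _ _).trans hz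
      rw [hlogm z hz0] at h2
      have h3 := mul_le_mul_of_nonneg_left (Complex.neg_pi_lt_arg (z * u)).le hN'.le
      by_contra! h4
      have h5 := mul_lt_mul_of_pos_left h4 hB0
      linarith
    · rw [hmM z hz0] at h
      linarith
  refine ⟨e, hdisk, g, hgc, hg0, ?_, η, hη0, ?_⟩
  · have : ¬ Real.exp (-M) ≤ m 0 := fun h => hm0 0 h rfl
    exact if_neg this
  intro z w hz1 hw1 hzw
  by_cases hzs : g z ≤ 2 * η ∧ g w ≤ 2 * η
  · have h1 := hsmall z hz1 hzs.1
    have h2 := hsmall w hw1 hzs.2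
    have := norm_sub_le (e.lift N z) (e.lift N w)
    linarith
  have hpos : 0 < g z ∧ 0 < g w := by
    have := abs_le.1 hzw
    by_contra hh
    apply hzs
    rw [not_and_or, not_lt, not_lt] at hh
    constructor <;> rcases hh with hh | hh <;> linarith
  have key : ∀ z, 0 < g z → z ≠ 0 ∧ -M ≤ height M (z ^ N) ∧
      g z = B * M + B * height M (z ^ N) + N * Complex.arg (z * u) - Real.pi * N := by
    intro z hz
    have h1 : Real.exp (-M) ≤ m z := by
      by_contra h
      have : g z = 0 := if_neg h
      linarith
    have hz0 := hm0 z h1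
    refine ⟨hz0, (hmM z hz0).1 h1, ?_⟩
    have h2 : g z = F z := if_pos h1
    rw [h2] at hz ⊢
    rw [← hlogm z hz0]
    rcases lt_max_iff.1 hz with h3 | h3
    · exact max_eq_left h3.le
    · exact absurd h3 (lt_irrefl _)
  obtain ⟨hz0, hzM, hgz⟩ := key z hpos.1
  obtain ⟨hw0, hwM, hgw⟩ := key w hpos.2
  have hτz : τ (height M (z ^ N)) = B * height M (z ^ N) := by
    rw [hτ]; dsimp only; rw [max_eq_left hzM]
  have hτw : τ (height M (w ^ N)) = B * height M (w ^ N) := by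
    rw [hτ]; dsimp only; rw [max_eq_left hwM]
  have e1 : ‖e.lift N z - e.lift N w‖ = ‖e.lift N z * u - e.lift N w * u‖ := by
    rw [← sub_mul, norm_mul, hun, mul_one]
  rw [e1, hlift z hz0, hlift w hw0, hτz, hτw]
  have hre : ∀ a b : ℝ, a ≤ 0 → (((a : ℂ) + b * Complex.I) / N).re ≤ 0 := fun a b ha => by
    rw [Complex.div_natCast_re]
    simpa using div_nonpos_of_nonpos_of_nonneg ha hN'.le
  refine (norm_exp_sub_exp_le (hre _ _ (hheight z hz1)) (hre _ _ (hheight w hw1))).trans_lt ?_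
  set a := height M (z ^ N)
  set b := height M (w ^ N)
  -- Arguments differ by at most `2π`, so `B * |a - b|` is at most `2 * η + 2πN`, and `B` was chosen
  -- to absorb this.
  have hab : |a - b| ≤ ε / 4 := by
    have h1 := mul_le_mul_of_nonneg_left (Complex.neg_pi_lt_arg (z * u)).le hN'.le
    have h2 := mul_le_mul_of_nonneg_left (Complex.neg_pi_lt_arg (w * u)).le hN'.le
    have h3 := mul_le_mul_of_nonneg_left (Complex.arg_le_pi (z * u)) hN'.le
    have h4 := mul_le_mul_of_nonneg_left (Complex.arg_le_pi (w * u)) hN'.le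
    have h5 := abs_le.1 hzw
    rw [hgz, hgw] at h5
    rw [abs_le]
    constructor
    · by_contra! h6
      have := mul_lt_mul_of_pos_left h6 hB0
      linarith
    · by_contra! h6
      have := mul_lt_mul_of_pos_left h6 hB0
      linarith
  have e2 : ((a : ℂ) + (B * a + N * Complex.arg (z * u) : ℝ) * Complex.I) / N -
      ((b : ℂ) + (B * b + N * Complex.arg (w * u) : ℝ) * Complex.I) / N =
      (((a - b : ℝ) : ℂ) + ((g z - g w : ℝ) : ℂ) * Complex.I) / N := by
    rw [hgz, hgw]
    push_cast
    ring
  rw [e2, norm_div, Complex.norm_natCast]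
  refine (div_le_self (norm_nonneg _) hN1).trans_lt ?_
  refine (norm_add_le _ _).trans_lt ?_
  rw [norm_mul, Complex.norm_I, mul_one, Complex.norm_real, Complex.norm_real, Real.norm_eq_abs,
    Real.norm_eq_abs]
  linarith

end ExpMap

/-! ### Zigzags along the roots of unity. -/

namespace ExpMap

theorem arg_div_norm {ζ : ℂ} (hζ : ζ ≠ 0) : Complex.arg (ζ / ‖ζ‖) = Complex.arg ζ := by
  rw [div_eq_mul_inv, ← Complex.ofReal_inv,
    Complex.arg_mul_real (inv_pos.2 (norm_pos_iff.2 hζ))]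

theorem abs_arg_le {ζ : ℂ} (hζ : ζ ≠ 0) : |Complex.arg ζ| ≤ 2 * ‖ζ / ‖ζ‖ - 1‖ := by
  have hn : 0 < ‖ζ‖ := norm_pos_iff.2 hζ
  have h1 : ‖ζ / ‖ζ‖‖ = 1 := by
    rw [norm_div, Complex.norm_real, norm_norm, div_self hn.ne']
  have h2 := Complex.angle_le_mul_norm_sub h1 norm_one
  have h0 : ζ / ‖ζ‖ ≠ 0 := by rw [← norm_ne_zero_iff, h1]; exact one_ne_zero
  rw [Complex.angle_one_right h0, arg_div_norm hζ] at h2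
  refine h2.trans (mul_le_mul_of_nonneg_right ?_ (norm_nonneg _))
  linarith [Real.pi_le_four]

/-- The branch cut is invisible: where the real part is negative, `|arg|` exceeds `π / 2 > 1`, so
`D` is evaluated where it vanishes. -/
theorem continuousOn_comp_arg {D : ℝ → ℝ} (hD : Continuous D) {s : ℝ} (hs : 0 < s)
    (h1 : ∀ t, 1 / s ≤ t → D t = 0) (h2 : ∀ t, t ≤ -(1 / s) → D t = 0) :
    ContinuousOn (fun ζ => D (Complex.arg ζ / s)) (Metric.sphere 0 1) := by
  intro ζ hζ
  refine ContinuousAt.continuousWithinAt ?_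
  have hζ0 : ζ ≠ 0 := by
    rintro rfl
    simp at hζ
  by_cases hre : ζ.re < 0
  · have h3 : ∀ᶠ w in 𝓝 ζ, (fun _ : ℂ => (0 : ℝ)) w = D (Complex.arg w / s) := by
      filter_upwards [(isOpen_lt Complex.continuous_re continuous_const).mem_nhds hre] with w hw
      have hw : w.re < 0 := hw
      have h4 : Real.pi / 2 < |Complex.arg w| := by
        by_contra! h5
        exact absurd (Complex.abs_arg_le_pi_div_two_iff.1 h5) (not_le.2 hw)
      have h5 := Real.pi_gt_three
      rcases lt_abs.1 h4 with h6 | h6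
      · refine (h1 _ ?_).symm
        gcongr
        linarith
      · refine (h2 _ ?_).symm
        rw [← neg_div]
        gcongr
        linarith
    exact continuousAt_const.congr h3
  · have hsl : ζ ∈ Complex.slitPlane := by
      rw [Complex.mem_slitPlane_iff]
      by_contra! h3
      exact hζ0 (Complex.ext (le_antisymm h3.1 (not_lt.1 hre)) h3.2)
    exact hD.continuousAt.comp ((Complex.continuousAt_arg hsl).div_const s)

set_option maxHeartbeats 1000000 in
/-- A map that squeezes the disk to a neighbourhood of a path running back and forth along the
positive real axis according to the displacement `D₀` of the logarithm of the radius; the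
`N`-fold lift does the same along all `N`-th roots of unity. -/
theorem exists_zigzag {N : ℕ} (hN : N ≠ 0) {ℓ : ℝ} (hℓ : 0 < ℓ) {D₀ : ℝ → ℝ}
    (hD : Continuous D₀) (hD1 : ∀ t ≤ -ℓ, D₀ t = 0) (hD2 : ∀ t, 0 ≤ t → D₀ t = 0)
    (hD3 : ∀ t, |D₀ t| ≤ ℓ) (hD4 : ∀ t ≤ 0, t + D₀ t ≤ 0) {δ : ℝ} (hδ : 0 < δ) :
    ∃ (e : ExpMap) (m : ℂ → ℝ) (ρ : ℂ → ℂ), e.MapsDisk ∧ Continuous m ∧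
      (∀ z, ‖z‖ ≤ 1 → m z ≤ 1) ∧
      ContinuousOn ρ (Metric.closedBall 0 1 ∩ {z | Real.exp (-(2 * ℓ)) ≤ m z}) ∧
      (∀ z, Real.exp (-(2 * ℓ)) ≤ m z → ρ z ^ N = 1) ∧
      (∀ z, ‖z‖ ≤ 1 → m z < Real.exp (-(2 * ℓ)) → ‖e.lift N z‖ ≤ Real.exp (-ℓ / N)) ∧
      (∀ z, ‖z‖ ≤ 1 → Real.exp (-(2 * ℓ)) ≤ m z →
        ‖e.lift N z - ρ z * Real.exp ((Real.log (m z) + D₀ (Real.log (m z))) / N)‖ < δ) := by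
  have hN' : (0 : ℝ) < N := by exact_mod_cast Nat.pos_of_ne_zero hN
  have hN1 : (1 : ℝ) ≤ N := by exact_mod_cast Nat.one_le_iff_ne_zero.2 hN
  have hNC : (N : ℂ) ≠ 0 := by exact_mod_cast hN
  -- A twist of small slope `s` tilts the squeezed disk, so that position along it can be read off
  -- from the direction. Rescaling each ray according to its direction then displaces the
  -- logarithmic radius by almost `D₀` and stays injective. The total tilt `s * M = β` is small. The
  -- factor `1 - k` leaves room for the thickness.
  set k : ℝ := min (1 / 2) (δ / (8 * ℓ)) with hk
  have hk0 : 0 < k := by positivity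
  have hk1 : k ≤ 1 / 2 := min_le_left _ _
  have hk2 : k * ℓ ≤ δ / 8 := by
    have : k ≤ δ / (8 * ℓ) := min_le_right _ _
    rw [le_div_iff₀ (by positivity)] at this
    linarith
  set β : ℝ := min (1 / 2) (δ / 8) with hβ
  have hβ0 : 0 < β := by positivity
  have hβ1 : β ≤ 1 / 2 := min_le_left _ _
  have hβ2 : β ≤ δ / 8 := min_le_right _ _
  -- Displacements are at most `ℓ`, so heights below `-2 * ℓ` end below `-ℓ`.
  set M : ℝ := 2 * ℓ with hM
  have hM0 : 0 < M := by positivity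
  set s : ℝ := β / M with hs
  have hs0 : 0 < s := by positivity
  have hsM : s * M = β := div_mul_cancel₀ _ hM0.ne'
  have hs1 : ℓ ≤ 1 / s := by
    rw [le_div_iff₀ hs0]
    nlinarith
  obtain ⟨γ, hγ, hDγ⟩ : ∃ γ > 0, ∀ x y, |x - y| < γ → |D₀ x - D₀ y| < δ / 8 := by
    have hcs : HasCompactSupport D₀ := by
      refine HasCompactSupport.intro (isCompact_Icc (a := -ℓ) (b := 0)) fun t ht => ?_
      rw [mem_Icc, not_and_or, not_le, not_le] at ht
      exact ht.elim (fun h => hD1 t h.le) fun h => hD2 t h.le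
    have huc := hcs.uniformContinuous_of_continuous hD
    obtain ⟨γ, hγ, h⟩ := Metric.uniformContinuous_iff.1 huc (δ / 8) (by positivity)
    exact ⟨γ, hγ, fun x y => @h x y⟩
  -- The three summands ensure in turn that reading heights off directions is accurate to `γ`, that
  -- angles before the twist are at most `β`, and that the slack gained from `k` beats the
  -- misreading.
  set K : ℝ := 4 * M / (s * γ) + 2 * M / β + 2 / (k * s) with hK
  have hK0 : 0 < K := by positivity
  have hK1 : 2 * M / K < s * γ := by
    rw [div_lt_iff₀ hK0]
    have : 4 * M / (s * γ) ≤ K := by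
      have h1 : 0 ≤ 2 * M / β := by positivity
      have h2 : 0 ≤ 2 / (k * s) := by positivity
      linarith
    rw [div_le_iff₀ (by positivity)] at this
    linarith
  have hK2 : 2 * M / K ≤ β := by
    rw [div_le_iff₀ hK0]
    have : 2 * M / β ≤ K := by
      have h1 : 0 ≤ 4 * M / (s * γ) := by positivity
      have h2 : 0 ≤ 2 / (k * s) := by positivity
      linarith
    rw [div_le_iff₀ (by positivity)] at this
    linarith
  have hK3 : 1 / s ≤ k * (K / 2) := by
    have : 2 / (k * s) ≤ K := by
      have h1 : 0 ≤ 4 * M / (s * γ) := by positivity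
      have h2 : 0 ≤ 2 * M / β := by positivity
      linarith
    rw [div_le_iff₀ (by positivity)] at this
    rw [div_le_iff₀ hs0]
    linarith
  set D : ℝ → ℝ := fun t => (1 - k) * D₀ t with hDdef
  have hDc : Continuous D := by fun_prop
  have hDabs : ∀ t, |D t| ≤ ℓ := fun t => by
    rw [hDdef]
    dsimp only
    rw [abs_mul, abs_of_nonneg (by linarith)]
    have := hD3 t
    nlinarith [abs_nonneg (D₀ t)]
  have hDabs' : ∀ t, D t ≤ ℓ := fun t => (le_abs_self _).trans (hDabs t)
  set C : ℂ → ℝ := fun ζ => D (Complex.arg ζ / s) with hC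
  have hCc : ContinuousOn C (Metric.sphere 0 1) :=
    continuousOn_comp_arg hDc hs0
      (fun t ht => by
        rw [hDdef]; dsimp only
        rw [hD2 t (by linarith), mul_zero])
      (fun t ht => by
        rw [hDdef]; dsimp only
        rw [hD1 t (by linarith), mul_zero])
  set σ : ℝ → ℝ := fun t => s * max t (-M) with hσ
  set e₁ : ExpMap := (twist σ (by fun_prop) (by simp [hσ, hM0.le])).comp (squeeze K hK0.le) with he₁
  set e : ExpMap := (radial C hCc ⟨ℓ, fun z => hDabs' _⟩
    (by simp [hC, hDdef, hD2 0 le_rfl])).comp e₁ with he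
  set c : ℂ → ℝ := fun v => D (Complex.arg (e₁.map v) / s) with hc
  have hκ₁ : ∀ v : ℂ, v ≠ 0 →
      e₁.κ v = (-(K * ‖v / ‖v‖ - 1‖) : ℝ) + σ (height K v) * Complex.I := by
    intro v hv
    have h1 : e₁.κ v = (-(K * ‖v / ‖v‖ - 1‖) : ℝ) +
        σ (Real.log ‖(squeeze K hK0.le).map v‖) * Complex.I := rfl
    rw [h1, log_norm_squeeze_map hK0.le hv]
  have hκ : ∀ v : ℂ, v ≠ 0 → Real.log ‖v‖ + e.κ v =
      (height K v + c v : ℝ) + σ (height K v) * Complex.I := by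
    intro v hv
    have h1 : e.κ v = e₁.κ v + C (e₁.map v / ‖e₁.map v‖) := rfl
    have h2 : C (e₁.map v / ‖e₁.map v‖) = c v := by
      rw [hC]
      dsimp only
      rw [arg_div_norm (ζ := e₁.map v) (mul_ne_zero hv (Complex.exp_ne_zero _))]
    rw [h1, h2, hκ₁ v hv, height]
    push_cast
    ring
  -- behaviour near the positive real axis
  have hnear : ∀ v : ℂ, v ≠ 0 → ‖v‖ ≤ 1 → -M ≤ height K v →
      |Complex.arg v| ≤ β ∧ |Complex.arg v / s| < γ ∧
      height K v ≤ -(K / 2 * |Complex.arg v|) ∧ σ (height K v) = s * height K v ∧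
      c v = D (height K v + Complex.arg v / s) := by
    intro v hv hv1 hvM
    have h1 := height_le (K := K) hv1
    have h2 := abs_arg_le hv
    have h3 : ‖v / ‖v‖ - 1‖ ≤ M / K := by
      rw [le_div_iff₀ hK0]; linarith
    have h4 : |Complex.arg v| ≤ 2 * M / K := by
      rw [mul_div_assoc]; linarith
    have h5 : σ (height K v) = s * height K v := by
      rw [hσ]; dsimp only; rw [max_eq_left hvM]
    have h6 : height K v ≤ -(K / 2 * |Complex.arg v|) := by nlinarith
    have h7 : |Complex.arg v| ≤ β := h4.trans hK2
    refine ⟨h7, ?_, h6, h5, ?_⟩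
    · rw [abs_div, abs_of_pos hs0, div_lt_iff₀ hs0]
      linarith
    · have h8 : e₁.map v = ((‖v‖ * Real.exp (-(K * ‖v / ‖v‖ - 1‖)) : ℝ) : ℂ) *
          (Complex.cos ((Complex.arg v + s * height K v : ℝ) : ℂ) +
            Complex.sin ((Complex.arg v + s * height K v : ℝ) : ℂ) * Complex.I) := by
        have hp := Complex.norm_mul_exp_arg_mul_I v
        have key : ∀ A B : ℂ, v * (A * B) =
            ‖v‖ * A * (Complex.exp (Complex.arg v * Complex.I) * B) := fun A B => by
          linear_combination (-(A * B)) * hp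
        rw [← Complex.exp_mul_I, map, hκ₁ v hv, h5, Complex.exp_add, key, ← Complex.exp_add,
          ← add_mul]
        push_cast
        rfl
      have h9 : 0 ≤ |Complex.arg v| := abs_nonneg _
      have h10 : height K v ≤ 0 := h6.trans (by rw [neg_nonpos]; positivity)
      have h11 : -β ≤ s * height K v := by
        rw [← hsM]; nlinarith
      have h12 : s * height K v ≤ 0 := mul_nonpos_of_nonneg_of_nonpos hs0.le h10
      have h13 := abs_le.1 h7
      have hpi := Real.pi_gt_three
      rw [hc]
      dsimp only
      rw [h8, Complex.arg_mul_cos_add_sin_mul_I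
        (mul_pos (norm_pos_iff.2 hv) (Real.exp_pos _)) ⟨by linarith, by linarith⟩]
      congr 1
      field_simp
      ring
  -- An angle `θ` misreads the height by `θ / s`, but the squeeze has already lowered the height by
  -- `K / 2 * |θ|`, and a `k`-th part of that compensates.
  have hneg : ∀ v : ℂ, v ≠ 0 → ‖v‖ ≤ 1 → height K v + c v ≤ 0 := by
    intro v hv hv1
    by_cases hvM : -M ≤ height K v
    · obtain ⟨h1, -, h3, -, h5⟩ := hnear v hv hv1 hvM
      rw [h5]
      set T := height K v
      set θ := Complex.arg v
      have h6 : |θ / s| ≤ k * (K / 2 * |θ|) := by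
        rw [abs_div, abs_of_pos hs0, div_eq_mul_one_div, mul_comm]
        calc 1 / s * |θ| ≤ k * (K / 2) * |θ| := by gcongr
          _ = _ := by ring
      have h9 : 0 ≤ K / 2 * |θ| := by positivity
      have h7 : T + θ / s ≤ 0 := by
        have := le_abs_self (θ / s)
        nlinarith
      have h8 := hD4 _ h7
      have h10 := neg_abs_le (θ / s)
      have h11 := le_abs_self (θ / s)
      have h12 : T + D (T + θ / s) = (1 - k) * (T + θ / s + D₀ (T + θ / s)) + k * T -
          (1 - k) * (θ / s) := by
        rw [hDdef]; ring
      rw [h12]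
      have h13 : (1 - k) * (T + θ / s + D₀ (T + θ / s)) ≤ 0 :=
        mul_nonpos_of_nonneg_of_nonpos (by linarith) h8
      have h14 : k * T ≤ k * (-(K / 2 * |θ|)) := by gcongr
      have h15 : -((1 - k) * (θ / s)) ≤ |θ / s| := by
        calc -((1 - k) * (θ / s)) = (1 - k) * -(θ / s) := by ring
          _ ≤ (1 - k) * |θ / s| := mul_le_mul_of_nonneg_left (neg_le_abs _) (by linarith)
          _ ≤ |θ / s| := mul_le_of_le_one_left (abs_nonneg _) (by linarith)
      linarith
    · have := hDabs' (Complex.arg (e₁.map v) / s)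
      have h2 : c v ≤ ℓ := this
      rw [hM] at hvM
      linarith
  have hdisk : e.MapsDisk := by
    intro v hv1
    by_cases hv : v = 0
    · simp [hv]
    have h1 : e.map v = Complex.exp (((height K v + c v : ℝ) + σ (height K v) * Complex.I) +
        Complex.arg v * Complex.I) := by
      rw [← hκ v hv, add_right_comm, Complex.exp_add]
      have : Complex.exp (Real.log ‖v‖ + Complex.arg v * Complex.I) = v := Complex.exp_log hv
      rw [this, map]
    rw [h1, Complex.norm_exp, Real.exp_le_one_iff]
    simpa using hneg v hv hv1
  set m : ℂ → ℝ := fun z => ‖(squeeze K hK0.le).map (z ^ N)‖ with hm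
  have hmc : Continuous m := ((continuous_map _).comp (continuous_pow N)).norm
  have hlogm : ∀ z : ℂ, z ≠ 0 → Real.log (m z) = height K (z ^ N) := fun z hz =>
    log_norm_squeeze_map hK0.le (pow_ne_zero _ hz)
  have hm0 : ∀ z, Real.exp (-M) ≤ m z → z ≠ 0 := by
    rintro z hz rfl
    have : m 0 = 0 := by simp [hm, zero_pow hN]
    rw [this] at hz
    exact absurd hz (not_le.2 (Real.exp_pos _))
  have hmM : ∀ z, z ≠ 0 → (Real.exp (-M) ≤ m z ↔ -M ≤ height K (z ^ N)) := fun z hz => by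
    rw [← hlogm z hz, Real.le_log_iff_exp_le]
    exact norm_pos_iff.2 (mul_ne_zero (pow_ne_zero _ hz) (Complex.exp_ne_zero _))
  have hpow1 : ∀ z : ℂ, ‖z‖ ≤ 1 → ‖z ^ N‖ ≤ 1 := fun z hz => by
    rw [norm_pow]; exact pow_le_one₀ (norm_nonneg _) hz
  -- The root of unity labelling the arm of `z`: what remains after dividing by the principal `N`-th
  -- root of `z ^ N`.
  set ρ : ℂ → ℂ := fun z => z / Complex.exp (Complex.log (z ^ N) / N) with hρ
  have hlift : ∀ z : ℂ, z ≠ 0 → e.lift N z = ρ z * Complex.exp (((height K (z ^ N) + c (z ^ N) : ℝ)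
      + (σ (height K (z ^ N)) + Complex.arg (z ^ N) : ℝ) * Complex.I) / N) := by
    intro z hz
    have h1 : (((height K (z ^ N) + c (z ^ N) : ℝ) : ℂ)
      + (σ (height K (z ^ N)) + Complex.arg (z ^ N) : ℝ) * Complex.I) =
      Complex.log (z ^ N) + e.κ (z ^ N) := by
      rw [Complex.log, add_right_comm, hκ _ (pow_ne_zero _ hz)]
      push_cast
      ring
    rw [h1, add_div, Complex.exp_add, hρ, lift]
    dsimp only
    rw [← mul_assoc, div_mul_cancel₀ _ (Complex.exp_ne_zero _)]
  have hρN : ∀ z, z ≠ 0 → ρ z ^ N = 1 := by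
    intro z hz
    rw [hρ]
    dsimp only
    rw [div_pow, ← Complex.exp_nat_mul, mul_div_cancel₀ _ hNC,
      Complex.exp_log (pow_ne_zero _ hz), div_self (pow_ne_zero _ hz)]
  have hρn : ∀ z, z ≠ 0 → ‖ρ z‖ = 1 := fun z hz => by
    have : ‖ρ z‖ ^ N = 1 := by rw [← norm_pow, hρN z hz, norm_one]
    exact (pow_eq_one_iff_of_nonneg (norm_nonneg _) hN).1 this
  refine ⟨e, m, ρ, hdisk, hmc, ?_, ?_, fun z hz => hρN z (hm0 z hz), ?_, ?_⟩
  · intro z hz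
    rw [hm]
    dsimp only
    rw [norm_squeeze_map]
    refine mul_le_one₀ (hpow1 z hz) (Real.exp_pos _).le (Real.exp_le_one_iff.2 ?_)
    rw [neg_nonpos]
    positivity
  · rintro z ⟨hz1, hz⟩
    rw [mem_closedBall_zero_iff] at hz1
    have hz0 := hm0 z hz
    have h1 := (hnear _ (pow_ne_zero N hz0) (hpow1 z hz1) ((hmM z hz0).1 hz)).1
    have hsl : z ^ N ∈ Complex.slitPlane := by
      rw [Complex.mem_slitPlane_iff_arg]
      refine ⟨fun h => ?_, pow_ne_zero N hz0⟩
      rw [h, abs_of_pos Real.pi_pos] at h1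
      linarith [Real.pi_gt_three]
    refine ContinuousAt.continuousWithinAt (continuousAt_id.div ?_ (Complex.exp_ne_zero _))
    refine Complex.continuous_exp.continuousAt.comp (ContinuousAt.div_const ?_ _)
    exact (continuousAt_clog hsl).comp (f := fun z : ℂ => z ^ N) (continuous_pow N).continuousAt
  · intro z hz1 hz
    by_cases hz0 : z = 0
    · rw [hz0, lift_zero, norm_zero]; exact (Real.exp_pos _).le
    rw [hlift z hz0, norm_mul, hρn z hz0, one_mul, Complex.norm_exp, Complex.div_natCast_re]
    have h1 : height K (z ^ N) < -M := not_le.1 fun h => absurd ((hmM z hz0).2 h) (not_le.2 hz)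
    have h2 : c (z ^ N) ≤ ℓ := hDabs' _
    gcongr
    simp only [Complex.add_re, Complex.ofReal_re, Complex.mul_re, Complex.I_re, mul_zero,
      Complex.ofReal_im, Complex.I_im, mul_one, sub_self, add_zero]
    linarith
  · intro z hz1 hz
    have hz0 := hm0 z hz
    have hv0 := pow_ne_zero N hz0
    obtain ⟨h1, h2, h3, h4, h5⟩ := hnear _ hv0 (hpow1 z hz1) ((hmM z hz0).1 hz)
    have h6 := hneg _ hv0 (hpow1 z hz1)
    rw [hlift z hz0, hlogm z hz0, h4]
    rw [h5] at h6 ⊢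
    have hTM := (hmM z hz0).1 hz
    set T := height K (z ^ N)
    set θ := Complex.arg (z ^ N)
    have hT0 : T ≤ 0 := h3.trans (by rw [neg_nonpos]; positivity)
    rw [Complex.ofReal_exp, ← mul_sub, norm_mul, hρn z hz0, one_mul]
    have hre : ∀ a b : ℝ, a ≤ 0 → (((a : ℂ) + b * Complex.I) / N).re ≤ 0 := fun a b ha => by
      rw [Complex.div_natCast_re]
      simpa using div_nonpos_of_nonpos_of_nonneg ha hN'.le
    have hre' : ((((T + D₀ T) / N : ℝ)) : ℂ).re ≤ 0 := by
      rw [Complex.ofReal_re]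
      exact div_nonpos_of_nonpos_of_nonneg (hD4 T hT0) hN'.le
    refine (norm_exp_sub_exp_le (hre _ _ h6) hre').trans_lt ?_
    have e1 : (((T + D (T + θ / s) : ℝ) : ℂ) + (s * T + θ : ℝ) * Complex.I) / N -
        (((T + D₀ T) / N : ℝ) : ℂ) = (((D (T + θ / s) - D₀ T : ℝ) : ℂ) +
          ((s * T + θ : ℝ) : ℂ) * Complex.I) / N := by
      push_cast
      ring
    rw [e1, norm_div, Complex.norm_natCast]
    refine (div_le_self (norm_nonneg _) hN1).trans_lt ?_
    refine (norm_add_le _ _).trans_lt ?_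
    rw [norm_mul, Complex.norm_I, mul_one, Complex.norm_real, Complex.norm_real, Real.norm_eq_abs,
      Real.norm_eq_abs]
    have h7 : |D₀ (T + θ / s) - D₀ T| < δ / 8 := hDγ _ _ (by rwa [add_sub_cancel_left])
    have h8 : D (T + θ / s) - D₀ T = (D₀ (T + θ / s) - D₀ T) - k * D₀ (T + θ / s) := by
      rw [hDdef]; ring
    have h9 : |D (T + θ / s) - D₀ T| ≤ δ / 8 + δ / 8 := by
      rw [h8]
      refine (abs_sub _ _).trans (add_le_add h7.le ?_)
      rw [abs_mul, abs_of_pos hk0]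
      exact (mul_le_mul_of_nonneg_left (hD3 _) hk0.le).trans hk2
    have h10 : |s * T + θ| ≤ δ / 8 + δ / 8 := by
      refine (abs_add_le _ _).trans (add_le_add ?_ (h1.trans hβ2))
      rw [abs_mul, abs_of_pos hs0, abs_of_nonpos hT0]
      have : s * -T ≤ s * M := by gcongr; linarith
      linarith
    linarith

end ExpMap

/-! ### Forcing crookedness by zigzags. -/

namespace ExpMap

/-- Any continuous function on the disk becomes crooked between two given levels after passing to
the `N`-fold lift of a suitable map. -/
theorem exists_isCrookedBetween {N : ℕ} (hN : N ≠ 0) {f : ℂ → ℝ}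
    (hf : ContinuousOn f (Metric.closedBall 0 1)) {a b η : ℝ} (hη : 0 < η) (hab : a + 2 * η ≤ b)
    (h0 : f 0 ≤ a) : ∃ e : ExpMap, e.MapsDisk ∧
      IsCrookedBetween (fun z : Metric.closedBall (0 : ℂ) 1 => f (e.lift N z)) a b η := by
  have hN' : (0 : ℝ) < N := by exact_mod_cast Nat.pos_of_ne_zero hN
  obtain ⟨r, hr, hfr⟩ : ∃ r > 0, ∀ z : ℂ, ‖z‖ ≤ 1 → ‖z‖ < r → f z ≤ a + η / 4 := by
    obtain ⟨r, hr, h⟩ := Metric.continuousOn_iff.1 hf 0 (by simp) (η / 4) (by positivity)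
    refine ⟨r, hr, fun z hz hzr => ?_⟩
    have := h z (by simpa using hz) (by simpa using hzr)
    rw [Real.dist_eq, abs_lt] at this
    linarith [this.2]
  obtain ⟨δ, hδ, hfδ⟩ : ∃ δ > 0, ∀ z w : ℂ, ‖z‖ ≤ 1 → ‖w‖ ≤ 1 → ‖z - w‖ < δ →
      |f z - f w| < η / 4 := by
    obtain ⟨δ, hδ, h⟩ := Metric.uniformContinuousOn_iff.1
      ((isCompact_closedBall (0 : ℂ) 1).uniformContinuousOn_of_continuous hf) (η / 4)
      (by positivity)
    refine ⟨δ, hδ, fun z w hz hw hzw => ?_⟩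
    have := h z (by simpa using hz) w (by simpa using hw) (by rwa [dist_eq_norm])
    rwa [Real.dist_eq] at this
  -- Downstairs logarithmic radius `-ℓ` corresponds upstairs to radius less than `r`, where `f` is
  -- almost at most `a`.
  set ℓ : ℝ := N * (|Real.log r| + 1) with hℓdef
  have hℓ : 0 < ℓ := by positivity
  have hℓr : Real.exp (-ℓ / N) < r := by
    rw [← Real.lt_log_iff_exp_lt hr, hℓdef, neg_div, mul_div_cancel_left₀ _ hN'.ne']
    have := neg_abs_le (Real.log r)
    linarith
  set R : Finset ℂ := Polynomial.nthRootsFinset N (1 : ℂ) with hR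
  have hRmem : ∀ ω, ω ∈ R ↔ ω ^ N = 1 := fun ω =>
    Polynomial.mem_nthRootsFinset (Nat.pos_of_ne_zero hN) _
  have hRn : ∀ ω ∈ R, ‖ω‖ = 1 := fun ω hω => by
    have : ‖ω‖ ^ N = 1 := by rw [← norm_pow, (hRmem ω).1 hω, norm_one]
    exact (pow_eq_one_iff_of_nonneg (norm_nonneg _) hN).1 this
  have hnorm : ∀ ω ∈ R, ∀ x : ℝ, ‖ω * Real.exp (x / N)‖ = Real.exp (x / N) := fun ω hω x => by
    rw [norm_mul, hRn ω hω, one_mul, Complex.norm_real, Real.norm_of_nonneg (Real.exp_pos _).le]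
  have hnorm1 : ∀ ω ∈ R, ∀ x : ℝ, x ≤ 0 → ‖ω * Real.exp (x / N)‖ ≤ 1 := fun ω hω x hx => by
    rw [hnorm ω hω, Real.exp_le_one_iff]
    exact div_nonpos_of_nonpos_of_nonneg hx hN'.le
  have hfar : ∀ ω ∈ R, ∀ x ≤ -ℓ, f (ω * Real.exp (x / N)) ≤ a + η / 4 := fun ω hω x hx => by
    refine hfr _ (hnorm1 ω hω x (by linarith)) ?_
    rw [hnorm ω hω]
    refine lt_of_le_of_lt ?_ hℓr
    gcongr
  -- The profile of `f` along the ray of `ω`; the `min` keeps the argument in the disk. The lift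
  -- acts alike on all `N` arms, so one path must fold all profiles. The levels are inset by `η / 2`
  -- to absorb the approximation error `η / 4`.
  set G : ℂ → ℝ → ℝ := fun ω s => f (ω * Real.exp (min (s - ℓ) 0 / N)) with hG
  obtain ⟨L', c₀, hL', hc₀, hc₀0, hc₀L, hm₀, hfold⟩ := exists_isFolded_finite R (G := G)
    (fun ω hω => hf.comp_continuous (by fun_prop) fun s => by
      rw [mem_closedBall_zero_iff]; exact hnorm1 ω hω _ (min_le_right _ _))
    (a := a + η / 2) (b := b - η / 2) (by linarith) hℓ.le
    (fun ω hω => by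
      rw [hG]
      dsimp only
      have := hfar ω hω (min (0 - ℓ) 0) ((min_le_left _ _).trans (by linarith))
      linarith)
  set p : ℝ → ℝ := fun t => max (-ℓ) (min t 0) with hp
  have hpI : ∀ t, -ℓ ≤ p t ∧ p t ≤ 0 := fun t =>
    ⟨le_max_left _ _, max_le (by linarith) (min_le_right _ _)⟩
  set q : ℝ → ℝ := fun t => L' * ((p t + ℓ) / ℓ) with hq
  have hqI : ∀ t, q t ∈ Icc 0 L' := fun t => by
    have h1 := hpI t
    have h2 : 0 ≤ (p t + ℓ) / ℓ := div_nonneg (by linarith) hℓ.le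
    have h3 : (p t + ℓ) / ℓ ≤ 1 := (div_le_one hℓ).2 (by linarith)
    exact ⟨mul_nonneg hL' h2, mul_le_of_le_one_right hL' h3⟩
  have hqc : Continuous q := by fun_prop
  -- On `[-ℓ, 0]` this gives `t + D₀ t = c₀ (q t) - ℓ`, the folding path in logarithmic radius. The
  -- endpoint values of `c₀` make `D₀` vanish outside.
  set D₀ : ℝ → ℝ := fun t => -ℓ - p t + c₀ (q t) with hD₀
  have hp1 : ∀ t ≤ -ℓ, p t = -ℓ := fun t ht => max_eq_left ((min_le_left _ _).trans ht)
  have hq1 : ∀ t ≤ -ℓ, q t = 0 := fun t ht => by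
    rw [hq]; dsimp only; rw [hp1 t ht]; simp
  have hp2 : ∀ t, -ℓ ≤ t → t ≤ 0 → p t = t := fun t ht ht' => by
    rw [hp]; dsimp only; rw [min_eq_left ht', max_eq_right ht]
  have hD1 : ∀ t ≤ -ℓ, D₀ t = 0 := fun t ht => by
    rw [hD₀]; dsimp only; rw [hq1 t ht, hp1 t ht, hc₀0]; ring
  have hD2 : ∀ t, 0 ≤ t → D₀ t = 0 := fun t ht => by
    have h1 : p t = 0 := by
      rw [hp]; dsimp only; rw [min_eq_right ht, max_eq_right (by linarith)]
    have h2 : q t = L' := by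
      rw [hq]; dsimp only; rw [h1, zero_add, div_self hℓ.ne', mul_one]
    rw [hD₀]; dsimp only; rw [h1, h2, hc₀L]; ring
  have hD3 : ∀ t, |D₀ t| ≤ ℓ := fun t => by
    have h1 := hpI t
    have h2 := hm₀ (hqI t)
    rw [hD₀, abs_le]
    constructor <;> linarith [h2.1, h2.2]
  have hD5 : ∀ t, -ℓ ≤ t → t ≤ 0 → t + D₀ t = c₀ (q t) - ℓ := fun t ht ht' => by
    rw [hD₀]; dsimp only; rw [hp2 t ht ht']; ring
  have hD4 : ∀ t ≤ 0, t + D₀ t ≤ 0 := fun t ht => by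
    rcases le_total t (-ℓ) with h1 | h1
    · rw [hD1 t h1]; linarith
    · rw [hD5 t h1 ht]
      linarith [(hm₀ (hqI t)).2]
  obtain ⟨e, m, ρ, he, hmc, hm1, hρc, hρN, hnear, hclose⟩ :=
    exists_zigzag hN hℓ (by fun_prop) hD1 hD2 hD3 hD4 hδ
  refine ⟨e, he, ?_⟩
  have hexp : Real.exp (-(2 * ℓ)) ≤ Real.exp (-ℓ) := Real.exp_le_exp.2 (by linarith)
  have hlog : ∀ z, ‖z‖ ≤ 1 → Real.exp (-ℓ) ≤ m z → -ℓ ≤ Real.log (m z) ∧ Real.log (m z) ≤ 0 :=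
    fun z hz hmz => ⟨(Real.le_log_iff_exp_le ((Real.exp_pos _).trans_le hmz)).2 hmz,
      Real.log_nonpos ((Real.exp_pos _).le.trans hmz) (hm1 z hz)⟩
  have harm : ∀ z, ‖z‖ ≤ 1 → Real.exp (-ℓ) ≤ m z →
      |f (e.lift N z) - (G (ρ z) ∘ c₀) (q (Real.log (m z)))| < η / 4 := by
    intro z hz hmz
    obtain ⟨h1, h2⟩ := hlog z hz hmz
    have hω := (hRmem _).2 (hρN z (hexp.trans hmz))
    have h3 := hclose z hz (hexp.trans hmz)
    rw [hD5 _ h1 h2] at h3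
    have h4 : c₀ (q (Real.log (m z))) - ℓ ≤ 0 := by linarith [(hm₀ (hqI (Real.log (m z)))).2]
    rw [comp_apply, hG]
    dsimp only
    rw [min_eq_left h4]
    exact hfδ _ _ (he.norm_lift_le hN hz) (hnorm1 _ hω _ h4) h3
  have hcenter : ∀ z, ‖z‖ ≤ 1 → m z ≤ Real.exp (-ℓ) → f (e.lift N z) ≤ a + η / 2 := by
    intro z hz hmz
    rcases lt_or_ge (m z) (Real.exp (-(2 * ℓ))) with h1 | h1
    · have := hfr _ (he.norm_lift_le hN hz) ((hnear z hz h1).trans_lt hℓr)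
      linarith
    · have hω := (hRmem _).2 (hρN z h1)
      have h2 : Real.log (m z) ≤ -ℓ := by
        rw [Real.log_le_iff_le_exp ((Real.exp_pos _).trans_le h1)]
        exact hmz
      have h3 := hclose z hz h1
      rw [hD1 _ h2, add_zero] at h3
      have h4 := hfδ _ _ (he.norm_lift_le hN hz) (hnorm1 _ hω _ (by linarith)) h3
      have h5 := hfar _ hω _ h2
      rw [abs_lt] at h4
      linarith [h4.2]
  choose! Y₀ Y₁ Y₂ k₀ k₁ k₂ _ _ _ hcov hY0 hd g0 g1 g2 g01 g12 using hfold
  have hmc' : Continuous fun z : Metric.closedBall (0 : ℂ) 1 => m z :=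
    hmc.comp continuous_subtype_val
  have hnz : ∀ z : Metric.closedBall (0 : ℂ) 1, ‖(z : ℂ)‖ ≤ 1 := fun z =>
    mem_closedBall_zero_iff.1 z.2
  have hclosed : ∀ Y : ℂ → Set ℝ, (∀ ω ∈ R, IsClosed (Y ω)) →
      IsClosed {z : Metric.closedBall (0 : ℂ) 1 | Real.exp (-ℓ) ≤ m z ∧
        q (Real.log (m z)) ∈ Y (ρ z)} := by
    intro Y hY
    have hS : IsClosed {z : Metric.closedBall (0 : ℂ) 1 | Real.exp (-ℓ) ≤ m z} :=
      isClosed_le continuous_const hmc'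
    have hcont : ContinuousOn (fun z : Metric.closedBall (0 : ℂ) 1 =>
        (ρ z, q (Real.log (m z)))) {z | Real.exp (-ℓ) ≤ m z} := by
      refine ContinuousOn.prodMk (hρc.comp continuous_subtype_val.continuousOn
        fun z hz => ⟨z.2, hexp.trans hz⟩) (hqc.comp_continuousOn ?_)
      exact hmc'.continuousOn.log fun z hz => ((Real.exp_pos _).trans_le hz).ne'
    have : {z : Metric.closedBall (0 : ℂ) 1 | Real.exp (-ℓ) ≤ m z ∧
        q (Real.log (m z)) ∈ Y (ρ z)} = ⋃ ω ∈ R,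
        {z : Metric.closedBall (0 : ℂ) 1 | Real.exp (-ℓ) ≤ m z} ∩
        (fun z : Metric.closedBall (0 : ℂ) 1 => (ρ z, q (Real.log (m z)))) ⁻¹' ({ω} ×ˢ Y ω) := by
      ext z
      simp only [mem_ofPred_eq, mem_iUnion, mem_inter_iff, mem_preimage, mem_prod,
        mem_singleton_iff, exists_prop]
      constructor
      · rintro ⟨h1, h2⟩
        exact ⟨ρ z, (hRmem _).2 (hρN _ (hexp.trans h1)), h1, rfl, h2⟩
      · rintro ⟨ω, -, h1, rfl, h2⟩
        exact ⟨h1, h2⟩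
    rw [this]
    exact isClosed_biUnion_finset fun ω hω =>
      hcont.preimage_isClosed_of_isClosed hS (isClosed_singleton.prod (hY ω hω))
  have hρR : ∀ z : Metric.closedBall (0 : ℂ) 1, Real.exp (-ℓ) ≤ m z → ρ z ∈ R := fun z hz =>
    (hRmem _).2 (hρN _ (hexp.trans hz))
  -- points on the inner boundary of an arm lie in its first piece
  have hinner : ∀ z : Metric.closedBall (0 : ℂ) 1, m z ≤ Real.exp (-ℓ) → Real.exp (-ℓ) ≤ m z →
      q (Real.log (m z)) ∈ Y₀ (ρ z) := fun z h1 h2 => by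
    rw [hq1 _ (by rw [le_antisymm h1 h2, Real.log_exp])]
    exact hY0 _ (hρR z h2)
  -- The center joins the first piece; each arm is cut according to the folding of its own profile.
  refine ⟨{z | m z ≤ Real.exp (-ℓ)} ∪ {z | Real.exp (-ℓ) ≤ m z ∧ q (Real.log (m z)) ∈ Y₀ (ρ z)},
    {z | Real.exp (-ℓ) ≤ m z ∧ q (Real.log (m z)) ∈ Y₁ (ρ z)},
    {z | Real.exp (-ℓ) ≤ m z ∧ q (Real.log (m z)) ∈ Y₂ (ρ z)},
    (isClosed_le hmc' continuous_const).union (hclosed _ k₀), hclosed _ k₁, hclosed _ k₂,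
    ?_, ?_, ?_, ?_, ?_, ?_⟩
  · intro z
    rcases le_total (m z) (Real.exp (-ℓ)) with h1 | h1
    · exact Or.inl (Or.inl h1)
    · rcases hcov _ (hρR z h1) _ (hqI (Real.log (m z))) with h2 | h2 | h2
      · exact Or.inl (Or.inr ⟨h1, h2⟩)
      · exact Or.inr (Or.inl ⟨h1, h2⟩)
      · exact Or.inr (Or.inr ⟨h1, h2⟩)
  · rintro z hz ⟨h1, h2⟩
    have h3 : q (Real.log (m z)) ∈ Y₀ (ρ z) := hz.elim (fun h => hinner z h h1) (·.2)
    exact hd _ (hρR z h1) _ h3 h2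
  · intro z hz
    rcases le_total (m z) (Real.exp (-ℓ)) with h1 | h1
    · exact Or.inl h1
    · have h2 := abs_lt.1 (harm z (hnz z) h1)
      rcases hcov _ (hρR z h1) _ (hqI (Real.log (m z))) with h3 | h3 | h3
      · exact Or.inr ⟨h1, h3⟩
      · have := (g1 _ (hρR z h1) _ h3).1
        linarith
      · have := g2 _ (hρR z h1) _ h3
        linarith
  · intro z hz
    rcases le_total (m z) (Real.exp (-ℓ)) with h1 | h1
    · have := hcenter z (hnz z) h1
      linarith
    · have h2 := abs_lt.1 (harm z (hnz z) h1)
      rcases hcov _ (hρR z h1) _ (hqI (Real.log (m z))) with h3 | h3 | h3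
      · have := g0 _ (hρR z h1) _ h3
        linarith
      · have := (g1 _ (hρR z h1) _ h3).2
        linarith
      · exact ⟨h1, h3⟩
  · rintro z hz ⟨h1, h2⟩
    have h3 : q (Real.log (m z)) ∈ Y₀ (ρ z) := hz.elim (fun h => hinner z h h1) (·.2)
    have h4 := g01 _ (hρR z h1) _ h3 h2
    have h5 := abs_lt.1 (harm z (hnz z) h1)
    linarith
  · rintro z ⟨h1, h2⟩ ⟨-, h3⟩
    have h4 := g12 _ (hρR z h1) _ h2 h3
    have h5 := abs_lt.1 (harm z (hnz z) h1)
    linarith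

end ExpMap

/-! ### Nested disks and the planar continuum. -/

theorem isCrookedBetween_of_lt {X : Type*} [TopologicalSpace X] {g : X → ℝ} {a b η : ℝ}
    (h : ∀ x, g x < b) : IsCrookedBetween g a b η :=
  ⟨univ, ∅, ∅, isClosed_univ, isClosed_empty, isClosed_empty, by simp, by simp, by simp,
    fun x hx => absurd (h x) (not_lt.2 hx), by simp, by simp⟩

/-- Disjoint neighbourhoods of two closed pieces of the intersection would, by compactness, already
cover some `K n`. -/
theorem isPreconnected_iInter_of_antitone {X : Type*} [TopologicalSpace X] [T2Space X]
    {K : ℕ → Set X} (hK : Antitone K) (hc : ∀ n, IsCompact (K n))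
    (hp : ∀ n, IsPreconnected (K n)) : IsPreconnected (⋂ n, K n) := by
  have hcl : IsClosed (⋂ n, K n) := isClosed_iInter fun n => (hc n).isClosed
  rw [isPreconnected_iff_subset_of_fully_disjoint_closed hcl]
  intro A B hA hB hAB hdisj
  have hcA : IsCompact ((⋂ n, K n) ∩ A) := ((hc 0).inter_right (hcl.inter hA)).of_isClosed_subset
    (hcl.inter hA) fun x hx => ⟨mem_iInter.1 hx.1 0, hx⟩
  have hcB : IsCompact ((⋂ n, K n) ∩ B) := ((hc 0).inter_right (hcl.inter hB)).of_isClosed_subset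
    (hcl.inter hB) fun x hx => ⟨mem_iInter.1 hx.1 0, hx⟩
  obtain ⟨U, V, hU, hV, hAU, hBV, hUV⟩ := SeparatedNhds.of_isCompact_isCompact hcA hcB
    (hdisj.mono inter_subset_right inter_subset_right)
  obtain ⟨n, hn⟩ := exists_subset_nhds_of_isCompact hK.directed_ge hc (U := U ∪ V)
    fun x hx => (hU.union hV).mem_nhds ((hAB hx).imp (fun h => hAU ⟨hx, h⟩) fun h => hBV ⟨hx, h⟩)
  rcases (hp n).subset_or_subset hU hV hUV hn with h | h
  · refine Or.inl fun x hx => (hAB hx).resolve_right fun hxB => ?_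
    exact hUV.le_bot ⟨h (mem_iInter.1 hx n), hBV ⟨hx, hxB⟩⟩
  · refine Or.inr fun x hx => (hAB hx).resolve_left fun hxA => ?_
    exact hUV.le_bot ⟨hAU ⟨hx, hxA⟩, h (mem_iInter.1 hx n)⟩

namespace ExpMap

/-- The restriction of a lift to the closed unit disk. -/
noncomputable def diskLift (e : ExpMap) (he : e.MapsDisk) {N : ℕ} (hN : N ≠ 0) :
    C(Metric.closedBall (0 : ℂ) 1, Metric.closedBall (0 : ℂ) 1) where
  toFun z := ⟨e.lift N z, mem_closedBall_zero_iff.2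
    (he.norm_lift_le hN (mem_closedBall_zero_iff.1 z.2))⟩
  continuous_toFun := by
    have := e.continuous_lift hN
    fun_prop

/-- Each new map is composed on the inside, so earlier crookedness is inherited; lifts fix 0, so the
value at 0 stays below every lower level. -/
theorem exists_isCrookedBetween_finset {N : ℕ} (hN : N ≠ 0) {g : ℂ → ℝ}
    (hg : ContinuousOn g (Metric.closedBall 0 1)) (hg0 : g 0 = 0) {η : ℝ} (hη : 0 < η)
    (s : Finset (ℕ × ℕ)) (hs : ∀ p ∈ s, p.1 + 2 ≤ p.2) : ∃ e : ExpMap, e.MapsDisk ∧ ∀ p ∈ s,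
      IsCrookedBetween (fun z : Metric.closedBall (0 : ℂ) 1 => g (e.lift N z))
        (p.1 * η) (p.2 * η) η := by
  classical
  induction s using Finset.induction_on with
  | empty => exact ⟨identity, mapsDisk_identity, by simp⟩
  | insert p s _ ih =>
    obtain ⟨e, he, hcr⟩ := ih fun p hp => hs p (Finset.mem_insert_of_mem hp)
    have hp : ((p.1 : ℝ) + 2) * η ≤ p.2 * η := by
      have := hs p (Finset.mem_insert_self p s)
      gcongr
      exact_mod_cast this
    obtain ⟨e', he', hcr'⟩ := exists_isCrookedBetween hN (f := g ∘ e.lift N) (a := p.1 * η)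
      (b := p.2 * η) (hg.comp (e.continuous_lift hN).continuousOn fun z hz => by
        rw [mem_closedBall_zero_iff] at hz ⊢
        exact he.norm_lift_le hN hz) hη (by linarith) (by
        simp only [comp_apply, lift_zero, hg0]; positivity)
    refine ⟨e.comp e', he.comp he', fun r hr => ?_⟩
    simp only [comp_lift _ _ hN]
    rcases Finset.mem_insert.1 hr with rfl | hr
    · exact hcr'
    · exact (hcr r hr).comp (e'.diskLift he' hN).continuous

/-- Uniform continuity of the lift of `h` tells how thin the spiral must be. Its function `g` is
bounded, so zigzags for finitely many pairs of grid levels suffice. -/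
theorem exists_hasCrookedMap (h : ExpMap) {N : ℕ} (hN : N ≠ 0) {ε : ℝ} (hε : 0 < ε) :
    ∃ e : ExpMap, e.MapsDisk ∧ HasCrookedMap (Metric.closedBall (0 : ℂ) 1)
      {p | dist ((h.comp e).lift N p.1) ((h.comp e).lift N p.2) < ε} := by
  obtain ⟨δ, hδ, hhδ⟩ := Metric.uniformContinuousOn_iff.1
    ((isCompact_closedBall (0 : ℂ) 1).uniformContinuousOn_of_continuous
      (h.continuous_lift hN).continuousOn) ε hε
  obtain ⟨e₀, he₀, g, hg, hgn, hg0, η, hη, hgη⟩ := exists_spiral hN hδ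
  obtain ⟨M, hM⟩ := ((isCompact_closedBall (0 : ℂ) 1).image_of_continuousOn hg).bddAbove
  have hM' : ∀ z, ‖z‖ ≤ 1 → g z ≤ M := fun z hz =>
    hM ⟨z, mem_closedBall_zero_iff.2 hz, rfl⟩
  obtain ⟨J, hJ⟩ := exists_nat_gt (M / η)
  rw [div_lt_iff₀ hη] at hJ
  obtain ⟨e₁, he₁, hcr⟩ := exists_isCrookedBetween_finset hN hg hg0 hη
    ((Finset.range J ×ˢ Finset.range J).filter fun p => p.1 + 2 ≤ p.2) (by simp)
  have hn₁ : ∀ z : Metric.closedBall (0 : ℂ) 1, ‖e₁.lift N z‖ ≤ 1 := fun z =>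
    he₁.norm_lift_le hN (mem_closedBall_zero_iff.1 z.2)
  refine ⟨e₀.comp e₁, he₀.comp he₁, fun z => g (e₁.lift N z), ?_, η, hη, ?_, fun z => hgn _, ?_⟩
  · exact hg.comp_continuous ((e₁.continuous_lift hN).comp continuous_subtype_val)
      fun z => mem_closedBall_zero_iff.2 (hn₁ z)
  · intro z w hzw
    rw [mem_ofPred_eq, comp_lift _ _ hN, comp_lift _ _ hN, comp_lift _ _ hN, comp_lift _ _ hN]
    refine hhδ _ ?_ _ ?_ ?_
    · exact mem_closedBall_zero_iff.2 (he₀.norm_lift_le hN (hn₁ z))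
    · exact mem_closedBall_zero_iff.2 (he₀.norm_lift_le hN (hn₁ w))
    · rw [dist_eq_norm]
      exact hgη _ _ (hn₁ z) (hn₁ w) hzw
  · intro i j hij
    by_cases hj : j < J
    · exact hcr (i, j) (by simp; omega)
    · refine isCrookedBetween_of_lt fun z => (hM' _ (hn₁ z)).trans_lt (hJ.trans_le ?_)
      gcongr
      exact_mod_cast not_lt.1 hj

/-- A nested sequence of disks satisfying all the crookedness conditions. -/
theorem exists_seq : ∃ H : ℕ → ExpMap, (∀ n, (H n).MapsDisk) ∧
    Antitone (fun n => (H n).map '' Metric.closedBall 0 1) ∧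
    ∀ N : ℕ, N ≠ 0 → ∀ ε > 0, ∃ n, HasCrookedMap (Metric.closedBall (0 : ℂ) 1)
      {p | dist ((H n).lift N p.1) ((H n).lift N p.2) < ε} := by
  choose! E hE hEc using fun (h : ExpMap) (N : ℕ) (hN : N ≠ 0) (ε : ℝ) (hε : 0 < ε) =>
    exists_hasCrookedMap h hN hε
  -- Unpairing runs through all exponents (shifted by 1 to be nonzero) and all precisions `1 / (k +
  -- 1)`.
  set c : ℕ → ExpMap → ExpMap := fun n h =>
    E h ((Nat.unpair n).1 + 1) (1 / ((Nat.unpair n).2 + 1)) with hc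
  have hcM : ∀ n h, (c n h).MapsDisk := fun n h =>
    hE h _ (Nat.succ_ne_zero _) _ Nat.one_div_pos_of_nat
  set H : ℕ → ExpMap := fun n => Nat.rec identity (fun n h => h.comp (c n h)) n with hH
  have hS : ∀ n, H (n + 1) = (H n).comp (c n (H n)) := fun n => rfl
  refine ⟨H, fun n => ?_, antitone_nat_of_succ_le fun n => ?_, fun N hN ε hε => ?_⟩
  · induction n with
    | zero => exact mapsDisk_identity
    | succ n ih => rw [hS]; exact ih.comp (hcM n _)
  · rintro _ ⟨z, hz, rfl⟩
    rw [mem_closedBall_zero_iff] at hz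
    refine ⟨(c n (H n)).map z, mem_closedBall_zero_iff.2 (hcM n _ z hz), ?_⟩
    rw [hS, comp_map]
  · obtain ⟨k, hk⟩ := exists_nat_one_div_lt hε
    refine ⟨Nat.pair (N - 1) k + 1, ?_⟩
    rw [hS]
    have := hEc (H (Nat.pair (N - 1) k)) N hN (1 / ((k : ℝ) + 1)) Nat.one_div_pos_of_nat
    have h2 : c (Nat.pair (N - 1) k) (H (Nat.pair (N - 1) k)) =
        E (H (Nat.pair (N - 1) k)) N (1 / ((k : ℝ) + 1)) := by
      rw [hc]
      simp only [Nat.unpair_pair, Nat.sub_one_add_one hN]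
    rw [h2]
    exact this.mono fun p hp => lt_trans hp hk

end ExpMap

/-- A plane continuum all of whose preimages under power maps are pseudo-arcs. -/
theorem exists_planar_continuum : ∃ P : Set ℂ, IsClosed P ∧ P ⊆ Metric.closedBall 0 1 ∧
    0 ∈ P ∧ 1 ∈ P ∧ ∀ N : ℕ, N ≠ 0 → IsPreconnected {w : ℂ | w ^ N ∈ P} ∧
      ∀ ε > 0, HasCrookedMap {w : ℂ | w ^ N ∈ P} {p | dist p.1 p.2 < ε} := by
  obtain ⟨H, hM, hanti, hcr⟩ := ExpMap.exists_seq
  have hcomp : ∀ N : ℕ, N ≠ 0 → ∀ n, IsCompact ((H n).lift N '' Metric.closedBall 0 1) :=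
    fun N hN n => (isCompact_closedBall _ _).image ((H n).continuous_lift hN)
  have hQ : ∀ N : ℕ, N ≠ 0 → {w : ℂ | w ^ N ∈ ⋂ n, (H n).map '' Metric.closedBall 0 1} =
      ⋂ n, (H n).lift N '' Metric.closedBall 0 1 := fun N hN => by
    ext w
    simp only [mem_ofPred_eq, mem_iInter, ExpMap.image_lift _ hN]
  refine ⟨⋂ n, (H n).map '' Metric.closedBall 0 1, ?_, ?_, ?_, ?_, fun N hN => ⟨?_, ?_⟩⟩
  · refine isClosed_iInter fun n => ?_
    rw [← ExpMap.lift_eq_map]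
    exact (hcomp 1 one_ne_zero n).isClosed
  · refine (iInter_subset _ 0).trans ?_
    rintro _ ⟨z, hz, rfl⟩
    rw [mem_closedBall_zero_iff] at hz ⊢
    exact hM 0 z hz
  · exact mem_iInter.2 fun n => ⟨0, by simp, by simp⟩
  · exact mem_iInter.2 fun n => ⟨1, by simp, by simp⟩
  · rw [hQ N hN]
    refine isPreconnected_iInter_of_antitone (fun i j hij => ?_) (hcomp N hN) fun n => ?_
    · rw [ExpMap.image_lift _ hN, ExpMap.image_lift _ hN]
      exact fun w hw => hanti hij hw
    · exact (convex_closedBall (0 : ℂ) 1).isPreconnected.image _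
        ((H n).continuous_lift hN).continuousOn
  · intro ε hε
    obtain ⟨n, hn⟩ := hcr N hN ε hε
    -- The preimage of `P` lies in the `n`-th lifted disk, so the inverse of the lift carries it
    -- into the unit disk, from which the crooked map is pulled back.
    set F : Metric.closedBall (0 : ℂ) 1 → ℂ := fun z => (H n).lift N z with hF
    have hFe : IsClosedEmbedding F :=
      (((H n).continuous_lift hN).comp continuous_subtype_val).isClosedEmbedding
        (((H n).injective_lift hN).comp Subtype.val_injective)
    set T := hFe.isEmbedding.toHomeomorph with hT
    have hsub : ∀ w : {w : ℂ | w ^ N ∈ ⋂ n, (H n).map '' Metric.closedBall 0 1},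
        (w : ℂ) ∈ range F := by
      rintro ⟨w, hw⟩
      rw [hQ N hN] at hw
      obtain ⟨z, hz, hzw⟩ := mem_iInter.1 hw n
      exact ⟨⟨z, hz⟩, hzw⟩
    have hφ : Continuous fun w : {w : ℂ | w ^ N ∈ ⋂ n, (H n).map '' Metric.closedBall 0 1} =>
        T.symm ⟨w, hsub w⟩ := by fun_prop
    have hval : ∀ w : {w : ℂ | w ^ N ∈ ⋂ n, (H n).map '' Metric.closedBall 0 1},
        (H n).lift N (T.symm ⟨w, hsub w⟩) = w := fun w =>
      congrArg Subtype.val (T.apply_symm_apply ⟨w, hsub w⟩)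
    refine (hn.comap hφ).mono ?_
    rintro ⟨w, w'⟩ hw
    have hw' : dist ((H n).lift N (T.symm ⟨w, hsub w⟩)) ((H n).lift N (T.symm ⟨w', hsub w'⟩)) < ε :=
      hw
    rwa [hval, hval] at hw'

/-! ### Inverse limits of continua -/

section InverseLimit

variable {X : ℕ → Type*}

theorem isClosed_inverseLimit [∀ n, TopologicalSpace (X n)] [∀ n, T2Space (X n)]
    {f : ∀ n, X (n + 1) → X n} (hf : ∀ n, Continuous (f n)) : IsClosed (inverseLimit f) := by
  have : inverseLimit f = ⋂ n, {x | f n (x (n + 1)) = x n} := by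
    ext x; simp [inverseLimit]
  rw [this]
  exact isClosed_iInter fun n =>
    isClosed_eq ((hf n).comp (continuous_apply _)) (continuous_apply _)

/-- The sequences compatible below level `n` form a retract of the product, since their lower
coordinates can be recomputed downwards from coordinate `n`. The limit is thus a decreasing
intersection of compact connected sets. -/
theorem isPreconnected_inverseLimit [∀ n, TopologicalSpace (X n)] [∀ n, T2Space (X n)]
    [∀ n, CompactSpace (X n)] [∀ n, PreconnectedSpace (X n)]
    {f : ∀ n, X (n + 1) → X n} (hf : ∀ n, Continuous (f n)) :
    IsPreconnected (inverseLimit f) := by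
  set A : ℕ → Set (∀ n, X n) := fun n => {x | ∀ i < n, f i (x (i + 1)) = x i} with hA
  -- a retraction of the product onto `A n`
  have key : ∀ n, ∃ Ψ : (∀ n, X n) → ∀ n, X n, Continuous Ψ ∧ (∀ x, Ψ x ∈ A n) ∧
      (∀ x, ∀ i, n ≤ i → Ψ x i = x i) ∧ ∀ x ∈ A n, Ψ x = x := by
    intro n
    induction n with
    | zero => exact ⟨id, continuous_id, by simp [hA], by simp, by simp⟩
    | succ n ih =>
      obtain ⟨Ψ, hc, hm, hfix, hid⟩ := ih
      refine ⟨fun x => Ψ (update x n (f n (x (n + 1)))), ?_, fun x i hi => ?_,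
        fun x i hi => ?_, fun x hx => ?_⟩
      · exact hc.comp (continuous_id.update n ((hf n).comp (continuous_apply _)))
      · rcases Nat.lt_succ_iff_lt_or_eq.1 hi with h | rfl
        · exact hm _ i h
        · dsimp only
          rw [hfix _ _ le_rfl, hfix _ _ (Nat.le_succ _), update_self,
            update_of_ne (Nat.succ_ne_self _)]
      · dsimp only
        rw [hfix _ i (by omega), update_of_ne (by omega)]
      · have h1 : update x n (f n (x (n + 1))) = x := by
          rw [hx n (Nat.lt_succ_self n), update_eq_self]
        dsimp only
        rw [h1]
        exact hid x fun i hi => hx i (by omega)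
  have h1 : inverseLimit f = ⋂ n, A n := by
    ext x
    simp only [mem_iInter]
    exact ⟨fun hx n i _ => hx i, fun hx n => hx (n + 1) n (Nat.lt_succ_self n)⟩
  rw [h1]
  refine isPreconnected_iInter_of_antitone (fun i j hij x hx k hk => hx k (hk.trans_le hij))
    (fun n => ?_) (fun n => ?_)
  · have : A n = ⋂ i, ⋂ _ : i < n, {x | f i (x (i + 1)) = x i} := by
      ext x; simp [hA]
    rw [this]
    exact (isClosed_iInter fun i => isClosed_iInter fun _ =>
      isClosed_eq ((hf i).comp (continuous_apply _)) (continuous_apply _)).isCompact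
  · obtain ⟨Ψ, hc, hm, -, hid⟩ := key n
    have : A n = range Ψ :=
      Subset.antisymm (fun x hx => ⟨x, hid x hx⟩) (range_subset_iff.2 hm)
    rw [this]
    exact isPreconnected_range hc

/-- Uniformly continuous bonding maps make the pulled-back uniformities decreasing in `n`, so a
single coordinate controls any entourage. -/
theorem exists_entourage_of_mem_uniformity_inverseLimit [∀ n, UniformSpace (X n)]
    {f : ∀ n, X (n + 1) → X n} (hf : ∀ n, UniformContinuous (f n))
    {V : Set (inverseLimit f × inverseLimit f)} (hV : V ∈ 𝓤 (inverseLimit f)) :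
    ∃ n, ∃ W ∈ 𝓤 (X n), ∀ x y : inverseLimit f, (x.1 n, y.1 n) ∈ W → (x, y) ∈ V := by
  set F : ℕ → Filter (inverseLimit f × inverseLimit f) := fun n =>
    comap (fun p => (p.1.1 n, p.2.1 n)) (𝓤 (X n)) with hF
  have h1 : 𝓤 (inverseLimit f) = ⨅ n, F n := by
    rw [uniformity_subtype, Pi.uniformity, comap_iInf]
    simp only [comap_comap]
    rfl
  have hanti : Antitone F := antitone_nat_of_succ_le fun n => by
    rw [hF]
    dsimp only
    have h2 : (fun p : inverseLimit f × inverseLimit f => (p.1.1 n, p.2.1 n)) =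
        Prod.map (f n) (f n) ∘ fun p => (p.1.1 (n + 1), p.2.1 (n + 1)) := by
      ext p
      · exact (p.1.2 n).symm
      · exact (p.2.2 n).symm
    rw [h2, ← comap_comap]
    exact comap_mono (hf n).le_comap
  rw [h1, mem_iInf_of_directed hanti.directed_ge] at hV
  obtain ⟨n, W, hW, hWV⟩ := hV
  exact ⟨n, W, hW, fun x y hxy => hWV hxy⟩

theorem isPseudoArc_inverseLimit [∀ n, UniformSpace (X n)]
    [∀ n, TopologicalSpace.MetrizableSpace (X n)] [∀ n, CompactSpace (X n)]
    [∀ n, PreconnectedSpace (X n)] {f : ∀ n, X (n + 1) → X n} (hf : ∀ n, Continuous (f n))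
    [Nontrivial (inverseLimit f)] (h : ∀ n, ∀ V ∈ 𝓤 (X n), HasCrookedMap (X n) V) :
    IsPseudoArc (inverseLimit f) := by
  have : CompactSpace (inverseLimit f) :=
    isCompact_iff_compactSpace.1 (isClosed_inverseLimit hf).isCompact
  have : PreconnectedSpace (inverseLimit f) :=
    isPreconnected_iff_preconnectedSpace.1 (isPreconnected_inverseLimit hf)
  have : ConnectedSpace (inverseLimit f) := { toNonempty := inferInstance }
  refine isPseudoArc_of_hasCrookedMap fun V hV => ?_
  obtain ⟨n, W, hW, hWV⟩ := exists_entourage_of_mem_uniformity_inverseLimit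
    (fun n => CompactSpace.uniformContinuous_of_continuous (hf n)) hV
  exact ((h n W hW).comap (φ := fun x : inverseLimit f => x.1 n)
    ((continuous_apply n).comp continuous_subtype_val)).mono
    fun p hp => hWV p.1 p.2 hp

end InverseLimit

/-! ### Power maps of the disk -/

/-- The closed unit disk. -/
abbrev unitDisk : Set ℂ := Metric.closedBall 0 1

/-- The power map of the closed unit disk. -/
def powMap (k : ℕ) (z : unitDisk) : unitDisk :=
  ⟨(z : ℂ) ^ k, by
    have := mem_closedBall_zero_iff.1 z.2
    rw [mem_closedBall_zero_iff, norm_pow]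
    exact pow_le_one₀ (norm_nonneg _) this⟩

theorem continuous_powMap (k : ℕ) : Continuous (powMap k) := by
  unfold powMap; fun_prop

theorem pow_mem_unitDisk_iff {k : ℕ} (hk : k ≠ 0) {z : ℂ} : z ^ k ∈ unitDisk ↔ z ∈ unitDisk := by
  rw [mem_closedBall_zero_iff, mem_closedBall_zero_iff, norm_pow,
    pow_le_one_iff_of_nonneg (norm_nonneg _) hk]

theorem isBranchedCover_powMap {k : ℕ} (hk : k ≠ 0) :
    IsBranchedCover (powMap k) k (0 : unitDisk) where
  continuous := continuous_powMap k
  covering := by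
    -- The disk is its own preimage, so restricting the target of the planar covering also gives the
    -- right domain.
    have h1 : unitDisk = (fun z : ℂ => z ^ k) ⁻¹' unitDisk := by
      ext z; exact (pow_mem_unitDisk_iff hk).symm
    have h2 := ((isCoveringMapOn_npow (𝕜 := ℂ) k (by exact_mod_cast hk)).restrictPreimage
      unitDisk).comp_homeomorph (Homeomorph.setCongr h1)
    convert h2 using 1
    · ext z
      rfl
    · ext z
      exact not_congr Subtype.ext_iff
  sheets y hy := by
    have hy0 : (y : ℂ) ≠ 0 := fun h => hy (Subtype.ext h)
    have hprim := Complex.isPrimitiveRoot_exp k hk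
    have h1 : Subtype.val '' (powMap k ⁻¹' {y}) = ((Polynomial.nthRoots k (y : ℂ)).toFinset : Set ℂ) := by
      ext z
      simp only [mem_image, mem_preimage, mem_singleton_iff, Finset.mem_coe, Multiset.mem_toFinset,
        Polynomial.mem_nthRoots (Nat.pos_of_ne_zero hk)]
      constructor
      · rintro ⟨w, hw, rfl⟩
        rw [← hw]; rfl
      · intro hz
        refine ⟨⟨z, (pow_mem_unitDisk_iff hk).1 (hz ▸ y.2)⟩, Subtype.ext hz, rfl⟩
    rw [← ncard_image_of_injective _ Subtype.val_injective, h1, ncard_coe_finset,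
      Multiset.toFinset_card_of_nodup (hprim.nthRoots_nodup hy0), hprim.card_nthRoots, if_pos]
    exact IsAlgClosed.exists_pow_nat_eq _ (Nat.pos_of_ne_zero hk)
  branch := by
    refine ⟨0, Subtype.ext (zero_pow hk), fun z hz => Subtype.ext ?_⟩
    have : (z : ℂ) ^ k = 0 := congrArg Subtype.val hz
    exact (pow_eq_zero_iff hk).1 this

/-- The preimage in the disk of a set under a power map. -/
def powPreimage (P : Set ℂ) (N : ℕ) : Set unitDisk := {z | (z : ℂ) ^ N ∈ P}

theorem powMap_preimage_powPreimage (P : Set ℂ) (N k : ℕ) :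
    powMap k ⁻¹' powPreimage P N = powPreimage P (N * k) := by
  ext z
  simp only [powPreimage, powMap, mem_preimage, mem_ofPred_eq, ← pow_mul, mul_comm]

section powPreimage

variable {P : Set ℂ} {N : ℕ}

theorem compactSpace_powPreimage (hP : IsClosed P) : CompactSpace (powPreimage P N) := by
  have hcl : IsClosed (powPreimage P N) :=
    hP.preimage (f := fun z : unitDisk => (z : ℂ) ^ N) (by fun_prop)
  have : CompactSpace unitDisk := isCompact_iff_compactSpace.1 (isCompact_closedBall _ _)
  exact isCompact_iff_compactSpace.1 hcl.isCompact

theorem preconnectedSpace_powPreimage (hN : N ≠ 0) (hP : P ⊆ unitDisk)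
    (hc : IsPreconnected {w : ℂ | w ^ N ∈ P}) : PreconnectedSpace (powPreimage P N) := by
  have := isPreconnected_iff_preconnectedSpace.1 hc
  set ψ : {w : ℂ | w ^ N ∈ P} → powPreimage P N := fun w =>
    ⟨⟨w, (pow_mem_unitDisk_iff hN).1 (hP w.2)⟩, w.2⟩ with hψ
  have h1 : Continuous ψ := by fun_prop
  have h2 : Surjective ψ := fun z => ⟨⟨z, z.2⟩, rfl⟩
  exact ⟨h2.range_eq ▸ isPreconnected_range h1⟩

theorem hasCrookedMap_powPreimage
    (hc : ∀ ε > 0, HasCrookedMap {w : ℂ | w ^ N ∈ P} {p | dist p.1 p.2 < ε}) :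
    ∀ V ∈ 𝓤 (powPreimage P N), HasCrookedMap (powPreimage P N) V := by
  intro V hV
  obtain ⟨ε, hε, hεV⟩ := Metric.mem_uniformity_dist.1 hV
  refine ((hc ε hε).comap (φ := fun z : powPreimage P N =>
    (⟨z, z.2⟩ : {w : ℂ | w ^ N ∈ P})) (by fun_prop)).mono ?_
  rintro ⟨z, w⟩ h
  exact hεV h

theorem isPseudoArc_powPreimage (hN : N ≠ 0) (hP : IsClosed P) (hPD : P ⊆ unitDisk) (h0 : 0 ∈ P)
    (h1 : 1 ∈ P) (hc : IsPreconnected {w : ℂ | w ^ N ∈ P})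
    (hcr : ∀ ε > 0, HasCrookedMap {w : ℂ | w ^ N ∈ P} {p | dist p.1 p.2 < ε}) :
    IsPseudoArc (powPreimage P N) := by
  have := compactSpace_powPreimage (N := N) hP
  have := preconnectedSpace_powPreimage hN hPD hc
  have z0 : (0 : unitDisk) ∈ powPreimage P N := by
    change (0 : ℂ) ^ N ∈ P
    rwa [zero_pow hN]
  have z1 : (1 : ℂ) ∈ unitDisk := by simp
  have z1' : (⟨1, z1⟩ : unitDisk) ∈ powPreimage P N := by
    change (1 : ℂ) ^ N ∈ P
    rwa [one_pow]
  have : Nontrivial (powPreimage P N) := ⟨⟨0, z0⟩, ⟨⟨1, z1⟩, z1'⟩, fun h => by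
    have : (0 : ℂ) = 1 := congrArg (fun z : powPreimage P N => (z : ℂ)) h
    exact zero_ne_one this⟩
  have : ConnectedSpace (powPreimage P N) := { toNonempty := inferInstance }
  exact isPseudoArc_of_hasCrookedMap (hasCrookedMap_powPreimage hcr)

end powPreimage

/-! ### The odometer action -/

theorem odometerModulus_succ (q : ℕ → ℕ) (n : ℕ) :
    odometerModulus q (n + 1) = odometerModulus q n * q n := Finset.prod_range_succ q n

theorem neZero_odometerModulus {q : ℕ → ℕ} (hq : ∀ n, (q n).Prime) (n : ℕ) :
    NeZero (odometerModulus q n) :=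
  ⟨Finset.prod_ne_zero_iff.2 fun i _ => (hq i).ne_zero⟩

/-- This growth prevents a positive integer from being divisible by every modulus. -/
theorem lt_odometerModulus {q : ℕ → ℕ} (hq : ∀ n, (q n).Prime) (n : ℕ) :
    n < odometerModulus q n := by
  have : 2 ^ n ≤ odometerModulus q n := by
    calc 2 ^ n = ∏ _i ∈ Finset.range n, 2 := by simp
      _ ≤ _ := Finset.prod_le_prod' fun i _ => (hq i).two_le
  exact Nat.lt_two_pow_self.trans_le this

/-- The `m`-th element of the odometer group. -/
def odometerInt (q : ℕ → ℕ) (m : ℤ) : OdometerSpace q :=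
  ⟨fun _ => m, fun n => map_intCast (odometerBond q n) m⟩

theorem odometerSpace_eq_of_le {q : ℕ → ℕ} (a : OdometerSpace q) (k : ℕ) {i n : ℕ} (hin : i ≤ n)
    (h : (k : ZMod (odometerModulus q n)) = a.1 n) : (k : ZMod (odometerModulus q i)) = a.1 i := by
  induction n, hin using Nat.le_induction with
  | base => exact h
  | succ n _ ih =>
    apply ih
    have h2 : odometerBond q n (a.1 (n + 1)) = a.1 n := a.2 n
    rw [← h2, ← h, map_natCast]

section Action

variable {q : ℕ → ℕ} {P : Set ℂ}

variable (q P) in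
/-- The inverse limit of the preimages of `P` under the power maps of exponents
`q 0 * ⋯ * q (n - 1)`. -/
abbrev powLimit : Set (∀ n, powPreimage P (odometerModulus q n)) :=
  subspaceInverseLimit (S := fun _ => unitDisk) (fun n => powMap (q n))
    (fun n => powPreimage P (odometerModulus q n))
    fun n _ hz => by
      rw [odometerModulus_succ, ← powMap_preimage_powPreimage] at hz
      exact hz

/-- The `n`-th coordinate of a point of the inverse limit, as a complex number. -/
def powLimitCoord (n : ℕ) (x : powLimit q P) : ℂ := ((x.1 n : unitDisk) : ℂ)

theorem powLimitCoord_succ_pow (n : ℕ) (x : powLimit q P) :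
    powLimitCoord (n + 1) x ^ q n = powLimitCoord n x := by
  have := x.2 n
  exact congrArg (fun z : powPreimage P (odometerModulus q n) => ((z : unitDisk) : ℂ)) this

theorem powLimit_ext {x y : powLimit q P} (h : ∀ n, powLimitCoord n x = powLimitCoord n y) :
    x = y :=
  Subtype.ext (funext fun n => Subtype.ext (Subtype.ext (h n)))

theorem continuous_powLimitCoord (n : ℕ) :
    Continuous (powLimitCoord n : powLimit q P → ℂ) := by
  unfold powLimitCoord
  exact continuous_subtype_val.comp (continuous_subtype_val.comp
    ((continuous_apply n).comp continuous_subtype_val))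

theorem continuous_odometerBond (n : ℕ) : Continuous (odometerBond q n) :=
  continuous_of_discreteTopology

variable [hq : ∀ n, NeZero (odometerModulus q n)]

theorem compactSpace_odometerSpace : CompactSpace (OdometerSpace q) :=
  isCompact_iff_compactSpace.1 (isClosed_inverseLimit continuous_odometerBond).isCompact

/-- The root of unity by which an element of `ℤ / (q 0 ⋯ q (n - 1))` acts on the plane. -/
noncomputable def odometerRoot (n : ℕ) (a : ZMod (odometerModulus q n)) : ℂ :=
  (ZMod.toCircle a : ℂ)

theorem odometerRoot_add (n : ℕ) (a b : ZMod (odometerModulus q n)) :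
    odometerRoot n (a + b) = odometerRoot n a * odometerRoot n b := by
  rw [odometerRoot, AddChar.map_add_eq_mul, Circle.coe_mul]; rfl

theorem odometerRoot_zero (n : ℕ) : odometerRoot n (0 : ZMod (odometerModulus q n)) = 1 := by
  rw [odometerRoot, AddChar.map_zero_eq_one, Circle.coe_one]

theorem norm_odometerRoot (n : ℕ) (a : ZMod (odometerModulus q n)) : ‖odometerRoot n a‖ = 1 :=
  Circle.norm_coe _

theorem odometerRoot_injective (n : ℕ) :
    Injective (odometerRoot n : ZMod (odometerModulus q n) → ℂ) :=
  Subtype.val_injective.comp ZMod.injective_toCircle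

theorem odometerRoot_pow (n : ℕ) (a : ZMod (odometerModulus q n)) :
    odometerRoot n a ^ odometerModulus q n = 1 := by
  rw [odometerRoot, ← Circle.coe_pow, ← AddChar.map_nsmul_eq_pow]
  simp

/-- Compatibility of the roots with the power maps is what makes the coordinatewise rotations act on
threads. -/
theorem odometerRoot_bond (n : ℕ) (a : ZMod (odometerModulus q (n + 1))) :
    odometerRoot (n + 1) a ^ q n = odometerRoot n (odometerBond q n a) := by
  obtain ⟨k, rfl⟩ := ZMod.intCast_surjective a
  rw [map_intCast, odometerRoot, odometerRoot, ZMod.toCircle_intCast, ZMod.toCircle_intCast,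
    ← Complex.exp_nat_mul, odometerModulus_succ]
  have h1 : ((odometerModulus q n : ℕ) : ℂ) ≠ 0 := by exact_mod_cast (hq n).ne
  have h2 : ((q n : ℕ) : ℂ) ≠ 0 := by
    have := (hq (n + 1)).ne
    rw [odometerModulus_succ] at this
    exact_mod_cast right_ne_zero_of_mul this
  congr 1
  push_cast
  field_simp

/-- The action of the odometer group on the inverse limit. -/
noncomputable def odometerAct (a : OdometerSpace q) (x : powLimit q P) : powLimit q P :=
  ⟨fun n => ⟨⟨powLimitCoord n x * odometerRoot n (a.1 n), by
      rw [mem_closedBall_zero_iff, norm_mul, norm_odometerRoot, mul_one]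
      exact mem_closedBall_zero_iff.1 (x.1 n).1.2⟩, by
      change (powLimitCoord n x * odometerRoot n (a.1 n)) ^ odometerModulus q n ∈ P
      rw [mul_pow, odometerRoot_pow, mul_one]
      exact (x.1 n).2⟩, fun n => by
    refine Subtype.ext (Subtype.ext ?_)
    change (powLimitCoord (n + 1) x * odometerRoot (n + 1) (a.1 (n + 1))) ^ q n =
      powLimitCoord n x * odometerRoot n (a.1 n)
    have h : odometerBond q n (a.1 (n + 1)) = a.1 n := a.2 n
    rw [mul_pow, odometerRoot_bond, h, powLimitCoord_succ_pow]⟩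

theorem powLimitCoord_odometerAct (n : ℕ) (a : OdometerSpace q) (x : powLimit q P) :
    powLimitCoord n (odometerAct a x) = powLimitCoord n x * odometerRoot n (a.1 n) := rfl

theorem continuous_odometerAct_left (x : powLimit q P) :
    Continuous fun a : OdometerSpace q => odometerAct a x := by
  refine Continuous.subtype_mk (continuous_pi fun n => Continuous.subtype_mk
    (Continuous.subtype_mk ?_ _) _) _
  have : Continuous (odometerRoot n : ZMod (odometerModulus q n) → ℂ) :=
    continuous_of_discreteTopology
  exact continuous_const.mul (this.comp ((continuous_apply n).comp continuous_subtype_val))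

theorem continuous_odometerAct_right (a : OdometerSpace q) :
    Continuous fun x : powLimit q P => odometerAct a x := by
  refine Continuous.subtype_mk (continuous_pi fun n => Continuous.subtype_mk
    (Continuous.subtype_mk ?_ _) _) _
  exact (continuous_powLimitCoord n).mul continuous_const

variable (q P) in
/-- The homeomorphism given by the generator of the odometer group. -/
noncomputable def odometerRotation : powLimit q P ≃ₜ powLimit q P where
  toFun := odometerAct (odometerInt q 1)
  invFun := odometerAct (odometerInt q (-1))
  left_inv x := powLimit_ext fun n => by
    rw [powLimitCoord_odometerAct, powLimitCoord_odometerAct, mul_assoc, ← odometerRoot_add]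
    simp [odometerInt, odometerRoot_zero]
  right_inv x := powLimit_ext fun n => by
    rw [powLimitCoord_odometerAct, powLimitCoord_odometerAct, mul_assoc, ← odometerRoot_add]
    simp [odometerInt, odometerRoot_zero]
  continuous_toFun := continuous_odometerAct_right _
  continuous_invFun := continuous_odometerAct_right _

theorem odometerRotation_odometerAct (a : OdometerSpace q) (x : powLimit q P) :
    odometerRotation q P (odometerAct a x) = odometerAct (odometer q a) x :=
  powLimit_ext fun n => by
    change powLimitCoord n (odometerAct (odometerInt q 1) (odometerAct a x)) = _
    rw [powLimitCoord_odometerAct, powLimitCoord_odometerAct, powLimitCoord_odometerAct,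
      mul_assoc, ← odometerRoot_add]
    simp [odometerInt, odometer]

theorem odometerAct_zero (x : powLimit q P) : odometerAct (odometerInt q 0) x = x :=
  powLimit_ext fun n => by
    rw [powLimitCoord_odometerAct]
    simp [odometerInt, odometerRoot_zero]

theorem odometerRotation_iterate (k : ℕ) (x : powLimit q P) :
    (odometerRotation q P)^[k] x = odometerAct (odometerInt q k) x := by
  induction k with
  | zero => exact (odometerAct_zero x).symm
  | succ k ih =>
    rw [iterate_succ_apply', ih, odometerRotation_odometerAct]
    congr 1
    exact Subtype.ext (funext fun n => by simp [odometer, odometerInt])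

/-- Arbitrarily large natural numbers approximate every odometer element, while the image of the
compact group is closed. -/
theorem omegaLimitSet_odometerRotation (hlt : ∀ n, n < odometerModulus q n) (x : powLimit q P) :
    omegaLimitSet (odometerRotation q P) x = range fun a => odometerAct a x := by
  ext y
  rw [omegaLimitSet, mem_omegaLimit_singleton_iff_mapClusterPt]
  simp only [odometerRotation_iterate]
  constructor
  · intro h
    have := compactSpace_odometerSpace (q := q)
    have hcl : IsClosed (range fun a : OdometerSpace q => odometerAct a x) :=
      (isCompact_range (continuous_odometerAct_left x)).isClosed
    exact hcl.mem_of_mapClusterPt h (Eventually.of_forall fun k => mem_range_self _)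
  · rintro ⟨a, rfl⟩
    -- The residue makes `κ n` agree with `a` up to level `n`; the multiple of the modulus pushes it
    -- to infinity.
    set κ : ℕ → ℕ := fun n => (a.1 n).val + n * odometerModulus q n with hκ
    have h1 : Tendsto κ atTop atTop := tendsto_atTop_mono (fun n => by
      have := hlt n
      rw [hκ]
      dsimp only
      have h2 : n * 1 ≤ n * odometerModulus q n := Nat.mul_le_mul_left n (by omega)
      change n ≤ _
      omega) tendsto_id
    refine MapClusterPt.of_comp h1 (Tendsto.mapClusterPt ?_)
    refine ((continuous_odometerAct_left x).tendsto a).comp ?_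
    rw [tendsto_subtype_rng, tendsto_pi_nhds]
    intro i
    refine tendsto_const_nhds.congr' ?_
    filter_upwards [eventually_ge_atTop i] with n hn
    have h2 : ((κ n : ℕ) : ZMod (odometerModulus q n)) = a.1 n := by
      rw [hκ]; simp
    have h3 := odometerSpace_eq_of_le a (κ n) hn h2
    simpa [odometerInt] using h3.symm

variable (q) in
/-- The fixed point of the odometer action. -/
noncomputable def powLimitZero (h0 : (0 : ℂ) ∈ P) (h : ∀ n, q n ≠ 0) : powLimit q P :=
  ⟨fun n => ⟨0, by
    change (0 : ℂ) ^ _ ∈ P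
    rwa [zero_pow (hq n).ne]⟩, fun n => Subtype.ext (Subtype.ext (zero_pow (h n)))⟩

theorem powLimitCoord_ne_zero {h0 : (0 : ℂ) ∈ P} {h : ∀ n, q n ≠ 0} {x : powLimit q P}
    (hx : x ≠ powLimitZero q h0 h) (n : ℕ) : powLimitCoord n x ≠ 0 := by
  intro hn
  apply hx
  have hup : ∀ n, powLimitCoord n x = 0 ↔ powLimitCoord (n + 1) x = 0 := fun n => by
    rw [← powLimitCoord_succ_pow n x, pow_eq_zero_iff (h n)]
  have hall : ∀ m, powLimitCoord m x = 0 ↔ powLimitCoord 0 x = 0 := fun m => by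
    induction m with
    | zero => rfl
    | succ m ih => rw [← hup, ih]
  exact powLimit_ext fun m => (hall m).2 ((hall n).1 hn)

/-- Off the zero thread every coordinate can be cancelled, and distinct residues give distinct
roots. -/
theorem odometerAct_injective {h0 : (0 : ℂ) ∈ P} {h : ∀ n, q n ≠ 0} {x : powLimit q P}
    (hx : x ≠ powLimitZero q h0 h) : Injective fun a : OdometerSpace q => odometerAct a x := by
  intro a b hab
  refine Subtype.ext (funext fun n => odometerRoot_injective n ?_)
  have := congrArg (powLimitCoord n) hab
  exact mul_left_cancel₀ (powLimitCoord_ne_zero hx n) this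

theorem odometerAct_powLimitZero (h0 : (0 : ℂ) ∈ P) (h : ∀ n, q n ≠ 0) (a : OdometerSpace q) :
    odometerAct a (powLimitZero q h0 h) = powLimitZero q h0 h :=
  powLimit_ext fun n => by
    rw [powLimitCoord_odometerAct]
    exact zero_mul _

theorem periodicPts_odometerRotation (hlt : ∀ n, n < odometerModulus q n) (h0 : (0 : ℂ) ∈ P)
    (h : ∀ n, q n ≠ 0) :
    periodicPts (odometerRotation q P) = {powLimitZero q h0 h} := by
  ext x
  rw [mem_singleton_iff]
  constructor
  · rintro ⟨k, hk, hx⟩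
    by_contra hne
    have h1 : odometerAct (odometerInt q k) x = odometerAct (odometerInt q 0) x := by
      rw [← odometerRotation_iterate, odometerAct_zero]; exact hx
    -- Coordinate `k` suffices, as its modulus exceeds `k`.
    have h2 := congrArg (fun a : OdometerSpace q => a.1 k) (odometerAct_injective hne h1)
    have h3 : ((k : ℕ) : ZMod (odometerModulus q k)) = 0 := by simpa [odometerInt] using h2
    rw [ZMod.natCast_eq_zero_iff] at h3
    exact absurd (Nat.le_of_dvd hk h3) (not_le.2 (hlt k))
  · rintro rfl
    refine ⟨1, one_pos, ?_⟩
    change odometerAct _ _ = _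
    exact odometerAct_powLimitZero h0 h _

theorem isTopologicallyConjugate_odometer (hlt : ∀ n, n < odometerModulus q n)
    {h0 : (0 : ℂ) ∈ P} {h : ∀ n, q n ≠ 0} {x : powLimit q P} (hx : x ≠ powLimitZero q h0 h) :
    ∃ hω : MapsTo (odometerRotation q P) (omegaLimitSet (odometerRotation q P) x)
      (omegaLimitSet (odometerRotation q P) x),
      IsTopologicallyConjugate (hω.restrict (odometerRotation q P) _ _) (odometer q) := by
  have hω := omegaLimitSet_odometerRotation hlt x
  have := compactSpace_odometerSpace (q := q)
  have he : IsEmbedding fun a : OdometerSpace q => odometerAct a x :=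
    ((continuous_odometerAct_left x).isClosedEmbedding (odometerAct_injective hx)).isEmbedding
  set E := he.toHomeomorph.trans (Homeomorph.setCongr hω.symm) with hE
  refine ⟨fun y hy => ?_, E.symm, fun y => ?_⟩
  · rw [hω] at hy ⊢
    obtain ⟨a, rfl⟩ := hy
    exact ⟨odometer q a, (odometerRotation_odometerAct a x).symm⟩
  · obtain ⟨a, rfl⟩ := E.surjective y
    rw [Homeomorph.symm_apply_apply, Homeomorph.symm_apply_eq]
    exact Subtype.ext (odometerRotation_odometerAct a x)

end Action

theorem theorem1p5 (q : ℕ → ℕ) (hq : ∀ n, (q n).Prime) :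
    ∃ (S : ℕ → Set ℂ) (φ : ∀ n, S (n + 1) → S n) (P : ∀ n, Set (S n))
      (hP : ∀ n, MapsTo (φ n) (P (n + 1)) (P n)) (o : ∀ n, P n),
      (∀ n, IsTwoDisk (S n)) ∧
      (∀ n, IsBranchedCover (φ n) (q n) (o n : S n)) ∧
      (∀ n, φ n ⁻¹' P n = P (n + 1)) ∧
      (∀ n, IsPseudoArc (P n)) ∧
      IsPseudoArc (subspaceInverseLimit (S := fun n => S n) φ P hP) ∧
      ∃ (R : subspaceInverseLimit (S := fun n => S n) φ P hP ≃ₜ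
              subspaceInverseLimit (S := fun n => S n) φ P hP)
        (oInf : subspaceInverseLimit (S := fun n => S n) φ P hP),
        (∀ n, oInf.1 n = o n) ∧
        periodicPts R = {oInf} ∧
        (∀ x, x ≠ oInf →
          ∃ hω : MapsTo R (omegaLimitSet R x) (omegaLimitSet R x),
            IsTopologicallyConjugate
              (hω.restrict R (omegaLimitSet R x) (omegaLimitSet R x)) (odometer q)) ∧
        (∀ x, x ∈ omegaLimitSet R x) := by
  obtain ⟨P, hP, hPD, h0, h1, hPN⟩ := exists_planar_continuum
  have hne := neZero_odometerModulus hq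
  have hq0 : ∀ n, q n ≠ 0 := fun n => (hq n).ne_zero
  have hlt := lt_odometerModulus hq
  have hcomp : ∀ n, CompactSpace (powPreimage P (odometerModulus q n)) := fun n =>
    compactSpace_powPreimage hP
  have hconn : ∀ n, PreconnectedSpace (powPreimage P (odometerModulus q n)) := fun n =>
    preconnectedSpace_powPreimage (hne n).ne hPD (hPN _ (hne n).ne).1
  have hpre : ∀ n, powMap (q n) ⁻¹' powPreimage P (odometerModulus q n) =
      powPreimage P (odometerModulus q (n + 1)) := fun n => by
    rw [odometerModulus_succ, powMap_preimage_powPreimage]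
  have hone : (1 : ℂ) ∈ unitDisk := by simp
  have hmaps : ∀ n, MapsTo (powMap (q n)) (powPreimage P (odometerModulus q (n + 1)))
      (powPreimage P (odometerModulus q n)) := fun n z hz => by
    rw [← hpre] at hz
    exact hz
  have : Nontrivial (powLimit q P) := by
    -- The normalization `κ 1 = 0` kept 1 in `P`; the constant thread 1 differs from the zero
    -- thread.
    refine ⟨powLimitZero q h0 hq0, ⟨fun n => ⟨⟨1, hone⟩, ?_⟩, fun n => ?_⟩, fun h => ?_⟩
    · change (1 : ℂ) ^ _ ∈ P
      rwa [one_pow]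
    · exact Subtype.ext (Subtype.ext (one_pow _))
    · exact zero_ne_one (congrArg (powLimitCoord 0) h)
  refine ⟨fun _ => unitDisk, fun n => powMap (q n), fun n => powPreimage P (odometerModulus q n),
    hmaps, fun n => (powLimitZero q h0 hq0).1 n, fun n => ⟨Homeomorph.refl _⟩,
    fun n => isBranchedCover_powMap (hq0 n), hpre,
    fun n => isPseudoArc_powPreimage (hne n).ne hP hPD h0 h1 (hPN _ (hne n).ne).1
      (hPN _ (hne n).ne).2,
    isPseudoArc_inverseLimit (fun n => ((continuous_powMap (q n)).comp
      continuous_subtype_val).subtype_mk _) (fun n => hasCrookedMap_powPreimage (hPN _ (hne n).ne).2),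
    odometerRotation q P, powLimitZero q h0 hq0, fun n => rfl,
    periodicPts_odometerRotation hlt h0 hq0,
    fun x hx => isTopologicallyConjugate_odometer hlt hx, fun x => ?_⟩
  have hω : omegaLimitSet (odometerRotation q P) x = range fun a => odometerAct a x :=
    omegaLimitSet_odometerRotation hlt x
  -- The neutral element gives recurrence, including at the fixed point.
  exact hω.ge ⟨odometerInt q 0, odometerAct_zero x⟩
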